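/- Let $m\ge 2$ be an integer. For $\beta>1$ and $x\in\mathbb{R}$ let $\Sigma_{\beta,m}(x)$ be the set of sequences $(\epsilon_i)_{i\ge1}\in\{0,\dots,m\}^{\mathbb{N}}$ with $\sum_{i=1}^\infty \epsilon_i\beta^{-i}=x$, and let $$U_{\beta,m}=\Big\{x\in\Big[0,\tfrac{m}{\beta-1}\Big] : |\Sigma_{\beta,m}(x)|=1\Big\}.$$ Call $g\in\mathbb{R}$ a generalised golden ratio for $m$ if for every $\beta\in(1,g)$ the set $\Sigma_{\beta,m}(x)$ is uncountable for every $x\in(0,\frac{m}{\beta-1})$, and for every $\beta\in(g,m+1]$ there is $x\in(0,\frac{m}{\beta-1})$ with $|\Sigma_{\beta,m}(x)|=1$. Let $(\lambda_i)_{i\ge0}$ be the Thue–Morse sequence: $\lambda_0=0$, $\lambda_{2i}=\lambda_i$, $\lambda_{2i+1}=1-\lambda_i$. For $i\ge1$ put $\lambda_i(m)=k+\lambda_i-\lambda_{i-1}$ if $m=2k$, and $\lambda_i(m)=k+\lambda_i$ if $m=2k+1$. There is exactly one generalised golden ratio $\mathcal{G}(m)$ for $m$, namely $\mathcal{G}(m)=k+1$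 if $m=2k$ and $\mathcal{G}(m)=\frac{k+1+\sqrt{k^2+6k+5}}{2}$ if $m=2k+1$; the equation $\sum_{i=1}^\infty\lambda_i(m)\beta^{-i}=1$ has exactly one solution $\beta=\beta_c(m)$ in $(1,\infty)$; and $\mathcal{G}(m)<\beta_c(m)<m+1$. Moreover: 1. $|U_{\beta,m}|=\aleph_0$ for every $\beta\in(\mathcal{G}(m),\beta_c(m))$; 2. $|U_{\beta,m}|=2^{\aleph_0}$ for $\beta=\beta_c(m)$; 3. $U_{\beta,m}$ has positive Hausdorff dimension for every $\beta\in(\beta_c(m),m+1]$. -/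

import Mathlib

noncomputable section

namespace BetaExpansion

/-- The set of `β`-expansions of `x` with digits in `{0, …, m}`. Sequences are indexed from `0`
here, so the `i`-th digit has weight `β ^ (-(i + 1))`. -/
def expansions (m : ℕ) (β x : ℝ) : Set (ℕ → Fin (m + 1)) :=
  {ε | HasSum (fun i : ℕ => ((ε i : ℕ) : ℝ) / β ^ (i + 1)) x}

/-- The set `U_{β,m}` of the points of `[0, m / (β - 1)]` with exactly one `β`-expansion. -/
def uniqueSet (m : ℕ) (β : ℝ) : Set ℝ :=
  {x | x ∈ Set.Icc 0 ((m : ℝ) / (β - 1)) ∧ (expansions m β x).encard = 1}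

/-- `g` is a generalised golden ratio for `m`. -/
def IsGeneralisedGoldenRatio (m : ℕ) (g : ℝ) : Prop :=
  (∀ β ∈ Set.Ioo 1 g, ∀ x ∈ Set.Ioo 0 ((m : ℝ) / (β - 1)), ¬ (expansions m β x).Countable) ∧
  (∀ β ∈ Set.Ioc g ((m : ℝ) + 1), ∃ x ∈ Set.Ioo 0 ((m : ℝ) / (β - 1)),
    (expansions m β x).encard = 1)

/-- The explicit value of the generalised golden ratio; `k = m / 2` is the integer part, so that
`m = 2 k` or `m = 2 k + 1`. -/
def goldenRatio (m : ℕ) : ℝ :=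
  let k : ℝ := ((m / 2 : ℕ) : ℝ)
  if Even m then k + 1 else (k + 1 + √(k ^ 2 + 6 * k + 5)) / 2

/-- The Thue–Morse sequence. -/
def thueMorse : ℕ → ℤ
  | 0 => 0
  | n + 1 =>
    if Even (n + 1) then thueMorse ((n + 1) / 2) else 1 - thueMorse ((n + 1) / 2)
decreasing_by all_goals omega

theorem thueMorse_zero : thueMorse 0 = 0 := by
  rw [thueMorse]

theorem thueMorse_two_mul (i : ℕ) : thueMorse (2 * i) = thueMorse i := by
  cases i with
  | zero => rfl
  | succ n =>
    have h : 2 * (n + 1) = (2 * n + 1) + 1 := by ring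
    rw [h, thueMorse, if_pos ⟨n + 1, by ring⟩]
    congr 1
    omega

theorem thueMorse_two_mul_add_one (i : ℕ) : thueMorse (2 * i + 1) = 1 - thueMorse i := by
  rw [thueMorse, if_neg (by simp)]
  congr 2
  omega

/-- The sequence `λ_i(m)`, for `i ≥ 1`: `k + λ_i - λ_{i-1}` if `m = 2 k` and `k + λ_i` if
`m = 2 k + 1`. -/
def criticalDigit (m i : ℕ) : ℤ :=
  if Even m then ((m / 2 : ℕ) : ℤ) + thueMorse i - thueMorse (i - 1)
  else ((m / 2 : ℕ) : ℤ) + thueMorse i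

/-- `β > 1` solves the equation `∑_{i ≥ 1} λ_i(m) / β ^ i = 1` that defines `β_c(m)`. -/
def IsCriticalBase (m : ℕ) (β : ℝ) : Prop :=
  1 < β ∧ HasSum (fun i : ℕ => (criticalDigit m (i + 1) : ℝ) / β ^ (i + 1)) 1

end BetaExpansion

end

noncomputable section

namespace BetaExpansion

open Filter Topology

variable {m : ℕ}

/-! For β ≤ m + 1, a sequence is the only expansion of its value exactly when every tail after a
digit below m, and every reflected tail after a positive digit, has value below 1: otherwise that
digit can be changed by one and the tail expanded anew (`IsUniq.eq_of_val_eq`, `isUniq_of_unique`).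
Apart from 0^∞ and m^∞, such a sequence ends in the core, where all tails obey both bounds. So the
size of the core decides everything.

Golden ratio: below it, every interior point can be steered, again and again, to a point with two
usable digits, so its expansions contain a Cantor set. Above it, k^∞ (m = 2k) or (k+1 k)^∞ (m =
2k+1) lies in the core.

Critical base: the base where the critical sequence c has value 1. Values decrease in the base, and
on the closed core their order is lexicographic. Among its own tails and their reflections c is the
largest (`critSeq_admissible`), so at the critical base c belongs to the closed core and bounds all
of it lexicographically. The bound is rigid: after the prefix of length 2^n comes its reflection or
the rest of the prefix of length 2^(n+1) (`LexBounded.next_block`).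

Below the critical base long prefixes of c have too large a value to occur, so core sequences end
periodically in one of countably many ways; zeros put before a core sequence give infinitely many
unique expansions. At the critical base the closure of the orbit of c contains a Cantor set, and
only countably many of its points have a tail or reflected tail of value 1. Above it there is slack:
blocks of c can be recombined according to a free binary code without leaving the core, and the
resulting exponentially separated set maps onto [0, 1] by a Hölder map. -/

/-! ### Values of digit sequences. -/

/-- The value `∑ aᵢ / β ^ (i + 1)` of a digit sequence in base `β`. -/
def val (β : ℝ) (a : ℕ → Fin (m + 1)) : ℝ := ∑' i : ℕ, ((a i : ℕ) : ℝ) / β ^ (i + 1)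

/-- The sequence with its first `n` terms removed. -/
def shift (n : ℕ) (a : ℕ → Fin (m + 1)) : ℕ → Fin (m + 1) := fun i => a (n + i)

/-- The reflected sequence, with digits `m - aᵢ`. -/
def conj (a : ℕ → Fin (m + 1)) : ℕ → Fin (m + 1) := fun i => Fin.rev (a i)

@[simp] theorem shift_apply (n i : ℕ) (a : ℕ → Fin (m + 1)) : shift n a i = a (n + i) := rfl

@[simp] theorem conj_apply (i : ℕ) (a : ℕ → Fin (m + 1)) : conj a i = Fin.rev (a i) := rfl

@[simp] theorem shift_zero (a : ℕ → Fin (m + 1)) : shift 0 a = a := by ext i; simp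

@[simp] theorem conj_conj (a : ℕ → Fin (m + 1)) : conj (conj a) = a := by ext i; simp

theorem shift_shift (n k : ℕ) (a : ℕ → Fin (m + 1)) : shift n (shift k a) = shift (k + n) a := by
  ext i; simp [add_assoc]

theorem conj_shift (n : ℕ) (a : ℕ → Fin (m + 1)) : conj (shift n a) = shift n (conj a) := rfl

theorem digit_le (a : ℕ → Fin (m + 1)) (i : ℕ) : ((a i : ℕ) : ℝ) ≤ m := by
  exact_mod_cast Nat.lt_succ_iff.mp (a i).2

theorem hasSum_const_digit {β : ℝ} (hβ : 1 < β) (d : ℝ) :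
    HasSum (fun i : ℕ => d / β ^ (i + 1)) (d / (β - 1)) := by
  have h0 : (0 : ℝ) < β := by linarith
  have h1 : β - 1 ≠ 0 := by linarith
  have h := (hasSum_geometric_of_lt_one (inv_nonneg.mpr h0.le) (inv_lt_one_of_one_lt₀ hβ)).mul_left
    (d / β)
  have e1 : (fun i : ℕ => d / β * β⁻¹ ^ i) = fun i : ℕ => d / β ^ (i + 1) := by
    funext i; rw [inv_pow, pow_succ]; field_simp
  have e2 : d / β * (1 - β⁻¹)⁻¹ = d / (β - 1) := by
    rw [div_mul_eq_mul_div, div_eq_div_iff h0.ne' h1]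
    have : 1 - β⁻¹ ≠ 0 := by
      rw [sub_ne_zero]; exact (inv_lt_one_of_one_lt₀ hβ).ne'
    field_simp
  rwa [e1, e2] at h

theorem summable_digits {β : ℝ} (hβ : 1 < β) (a : ℕ → Fin (m + 1)) :
    Summable (fun i : ℕ => ((a i : ℕ) : ℝ) / β ^ (i + 1)) := by
  have h0 : (0 : ℝ) < β := by linarith
  refine Summable.of_nonneg_of_le (fun i => by positivity) (fun i => ?_)
    (hasSum_const_digit hβ (m : ℝ)).summable
  have := digit_le a i
  gcongr

theorem mem_expansions_iff {β x : ℝ} (hβ : 1 < β) (a : ℕ → Fin (m + 1)) :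
    a ∈ expansions m β x ↔ val β a = x :=
  (summable_digits hβ a).hasSum_iff

theorem val_nonneg {β : ℝ} (hβ : 1 < β) (a : ℕ → Fin (m + 1)) : 0 ≤ val β a := by
  have h0 : (0 : ℝ) < β := by linarith
  exact tsum_nonneg fun i => by positivity

theorem val_conj {β : ℝ} (hβ : 1 < β) (a : ℕ → Fin (m + 1)) :
    val β (conj a) = m / (β - 1) - val β a := by
  have h := (hasSum_const_digit hβ (m : ℝ)).sub (summable_digits hβ a).hasSum
  rw [← val] at h
  rw [← h.tsum_eq, val]
  refine tsum_congr fun i => ?_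
  have : ((conj a i : ℕ) : ℝ) = m - (a i : ℕ) := by
    rw [conj_apply, Fin.val_rev, eq_sub_iff_add_eq]
    exact_mod_cast (by have := (a i).2; omega : m + 1 - ((a i : ℕ) + 1) + (a i : ℕ) = m)
  rw [this, sub_div]

theorem val_le {β : ℝ} (hβ : 1 < β) (a : ℕ → Fin (m + 1)) : val β a ≤ m / (β - 1) := by
  have := val_nonneg hβ (conj a)
  rw [val_conj hβ] at this
  linarith

theorem val_eq_sum_add {β : ℝ} (hβ : 1 < β) (a : ℕ → Fin (m + 1)) (n : ℕ) :
    val β a = ∑ i ∈ Finset.range n, ((a i : ℕ) : ℝ) / β ^ (i + 1) + val β (shift n a) / β ^ n := by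
  have h0 : (0 : ℝ) < β := by linarith
  rw [val, ← (summable_digits hβ a).sum_add_tsum_nat_add n, val, ← tsum_div_const]
  congr 1
  refine tsum_congr fun i => ?_
  rw [shift_apply, add_comm n i, div_div, ← pow_add]
  ring_nf

theorem sum_le_val {β : ℝ} (hβ : 1 < β) (a : ℕ → Fin (m + 1)) (n : ℕ) :
    ∑ i ∈ Finset.range n, ((a i : ℕ) : ℝ) / β ^ (i + 1) ≤ val β a := by
  have h0 : (0 : ℝ) < β := by linarith
  rw [val_eq_sum_add hβ a n]
  have := val_nonneg hβ (shift n a)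
  have : 0 ≤ val β (shift n a) / β ^ n := by positivity
  linarith

theorem val_succ {β : ℝ} (hβ : 1 < β) (a : ℕ → Fin (m + 1)) :
    β * val β a = (a 0 : ℕ) + val β (shift 1 a) := by
  have h0 : (0 : ℝ) < β := by linarith
  rw [val_eq_sum_add hβ a 1]
  simp
  field_simp

theorem val_shift_succ {β : ℝ} (hβ : 1 < β) (a : ℕ → Fin (m + 1)) (n : ℕ) :
    β * val β (shift n a) = (a n : ℕ) + val β (shift (n + 1) a) := by
  rw [val_succ hβ, shift_shift]; rfl

theorem val_sub_of_agree {β : ℝ} (hβ : 1 < β) {a b : ℕ → Fin (m + 1)} {n : ℕ}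
    (h : ∀ i < n, a i = b i) :
    val β a - val β b = (val β (shift n a) - val β (shift n b)) / β ^ n := by
  rw [val_eq_sum_add hβ a n, val_eq_sum_add hβ b n,
    Finset.sum_congr rfl fun i hi => by rw [h i (Finset.mem_range.mp hi)]]
  ring

/-- The difference of the values, read off at the first index where the sequences may differ. -/
theorem val_sub_of_agree_succ {β : ℝ} (hβ : 1 < β) {a b : ℕ → Fin (m + 1)} {n : ℕ}
    (h : ∀ i < n, a i = b i) :
    β ^ (n + 1) * (val β a - val β b) =
      ((a n : ℕ) : ℝ) - (b n : ℕ) + (val β (shift (n + 1) a) - val β (shift (n + 1) b)) := by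
  have h0 : (0 : ℝ) < β := by linarith
  rw [val_sub_of_agree hβ h, pow_succ]
  have h1 := val_shift_succ hβ a n
  have h2 := val_shift_succ hβ b n
  field_simp
  linarith

theorem val_pos {β : ℝ} (hβ : 1 < β) {a : ℕ → Fin (m + 1)} {n : ℕ} (h : 0 < a n) :
    0 < val β a := by
  have h0 : (0 : ℝ) < β := by linarith
  refine (summable_digits hβ a).tsum_pos (fun i => by positivity) n ?_
  have : (0 : ℝ) < ((a n : ℕ) : ℝ) := by exact_mod_cast h
  positivity

/-- Multiplying by the base leaves the first digit with weight 1, so only the other terms shrink.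
Compared with plain monotonicity this gains the factor β / γ, which supplies the slack above the
critical base. -/
theorem mul_val_le_mul_val {β γ : ℝ} (hβ : 1 < β) (h : β ≤ γ) (a : ℕ → Fin (m + 1)) :
    γ * val γ a ≤ β * val β a := by
  have h0 : (0 : ℝ) < β := by linarith
  have h1 : (0 : ℝ) < γ := by linarith
  have hγ : 1 < γ := by linarith
  rw [val, val, ← tsum_mul_left, ← tsum_mul_left]
  refine Summable.tsum_le_tsum (fun i => ?_) ((summable_digits hγ a).mul_left _)
    ((summable_digits hβ a).mul_left _)
  rw [pow_succ, pow_succ]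
  calc γ * (((a i : ℕ) : ℝ) / (γ ^ i * γ)) = ((a i : ℕ) : ℝ) / γ ^ i := by field_simp
    _ ≤ ((a i : ℕ) : ℝ) / β ^ i := by gcongr
    _ = _ := by field_simp

theorem val_anti {β γ : ℝ} (hβ : 1 < β) (h : β ≤ γ) (a : ℕ → Fin (m + 1)) :
    val γ a ≤ val β a := by
  have h1 := mul_val_le_mul_val hβ h a
  have h2 := val_nonneg (lt_of_lt_of_le hβ h) a
  nlinarith

theorem val_strictAnti {β γ : ℝ} (hβ : 1 < β) (h : β < γ) {a : ℕ → Fin (m + 1)} {n : ℕ}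
    (ha : 0 < a n) : val γ a < val β a := by
  have h1 := mul_val_le_mul_val hβ h.le a
  have h2 := val_pos (hβ.trans h) ha
  nlinarith

/-! ### Existence of expansions and the uniqueness criterion. -/

/-- If every point of a bounded set `I` has a digit that keeps it in `I`, then every point of `I`
has an expansion all of whose tails have their values in `I`. -/
theorem exists_expansion {β : ℝ} (hβ : 1 < β) {I : Set ℝ} {C : ℝ} (hC : ∀ y ∈ I, |y| ≤ C)
    (hI : ∀ y ∈ I, ∃ d : Fin (m + 1), β * y - (d : ℕ) ∈ I) {y : ℝ} (hy : y ∈ I) :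
    ∃ a : ℕ → Fin (m + 1), val β a = y ∧ ∀ n, val β (shift n a) ∈ I := by
  have h0 : (0 : ℝ) < β := by linarith
  choose! d hd using hI
  let T : ℝ → ℝ := fun y => β * y - (d y : ℕ)
  have hT : ∀ n, ∀ y ∈ I, T^[n] y ∈ I := by
    intro n
    induction n with
    | zero => intro y hy; exact hy
    | succ n ih => intro y hy; rw [Function.iterate_succ_apply]; exact ih _ (hd y hy)
  have key : ∀ y ∈ I, val β (fun n => d (T^[n] y)) = y := by
    intro y hy
    have hsum : ∀ n, ∑ i ∈ Finset.range n, ((d (T^[i] y) : ℕ) : ℝ) / β ^ (i + 1) =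
        y - T^[n] y / β ^ n := by
      intro n
      induction n with
      | zero => simp
      | succ n ih =>
        rw [Finset.sum_range_succ, ih, Function.iterate_succ_apply']
        simp only [T]
        rw [pow_succ]
        field_simp
        ring
    have h1 := (summable_digits hβ (fun n => d (T^[n] y))).hasSum.tendsto_sum_nat
    have h2 : Tendsto (fun n => y - T^[n] y / β ^ n) atTop (𝓝 (y - 0)) := by
      refine tendsto_const_nhds.sub ?_
      have h3 : Tendsto (fun n : ℕ => C * (β⁻¹) ^ n) atTop (𝓝 (C * 0)) :=
        (tendsto_pow_atTop_nhds_zero_of_lt_one (by positivity)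
          (inv_lt_one_of_one_lt₀ hβ)).const_mul C
      rw [mul_zero] at h3
      refine squeeze_zero_norm (fun n => ?_) h3
      rw [Real.norm_eq_abs, abs_div, abs_of_pos (pow_pos h0 n), inv_pow, div_eq_mul_inv]
      have := hC _ (hT n y hy)
      gcongr
    simp only [hsum] at h1
    simpa [val] using tendsto_nhds_unique h1 h2
  refine ⟨fun n => d (T^[n] y), key y hy, fun n => ?_⟩
  have : shift n (fun n => d (T^[n] y)) = fun k => d (T^[k] (T^[n] y)) := by
    funext i; rw [shift_apply, ← Function.iterate_add_apply, Nat.add_comm n i]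
  rw [this, key _ (hT n y hy)]
  exact hT n y hy

theorem exists_val_eq {β x : ℝ} (hβ : 1 < β) (hβm : β ≤ m + 1)
    (hx : x ∈ Set.Icc 0 ((m : ℝ) / (β - 1))) : ∃ a : ℕ → Fin (m + 1), val β a = x := by
  have h1 : 0 < β - 1 := by linarith
  have hL : 1 ≤ (m : ℝ) / (β - 1) := by rw [le_div_iff₀ h1]; linarith
  have hL' : (m : ℝ) / (β - 1) * (β - 1) = m := by field_simp
  set L := (m : ℝ) / (β - 1)
  have step : ∀ y ∈ Set.Icc 0 L, ∃ d : Fin (m + 1), β * y - (d : ℕ) ∈ Set.Icc 0 L := by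
    rintro y ⟨hy0, hy1⟩
    have hb : 0 ≤ β * y := by positivity
    rcases le_or_gt (m : ℝ) (β * y) with h | h
    · refine ⟨Fin.last m, ?_, ?_⟩
      · simpa using h
      · simp only [Fin.val_last]; nlinarith
    · have hlt : ⌊β * y⌋₊ < m + 1 := by
        have := Nat.floor_le hb
        have : ((⌊β * y⌋₊ : ℕ) : ℝ) < m := by linarith
        have : ⌊β * y⌋₊ < m := by exact_mod_cast this
        omega
      refine ⟨⟨⌊β * y⌋₊, hlt⟩, ?_, ?_⟩
      · have := Nat.floor_le hb; simp only; linarith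
      · have := Nat.lt_floor_add_one (β * y); simp only; linarith
  obtain ⟨a, ha, -⟩ := exists_expansion hβ (C := L)
    (fun y hy => by rw [abs_of_nonneg hy.1]; exact hy.2) step hx
  exact ⟨a, ha⟩

/-- The digit criterion for a sequence to be the only expansion of its value. -/
def IsUniq (β : ℝ) (a : ℕ → Fin (m + 1)) : Prop :=
  ∀ n, (a n < Fin.last m → val β (shift (n + 1) a) < 1) ∧
    (0 < a n → val β (conj (shift (n + 1) a)) < 1)

theorem IsUniq.conj {β : ℝ} {a : ℕ → Fin (m + 1)} (h : IsUniq β a) : IsUniq β (conj a) := by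
  intro n
  refine ⟨fun hn => ?_, fun hn => ?_⟩
  · have := (h n).2 (by rw [conj_apply] at hn; rw [Fin.lt_def] at *; simp at *; omega)
    rwa [conj_shift] at this
  · have := (h n).1 (by rw [conj_apply] at hn; rw [Fin.lt_def] at *; simp at *; omega)
    rwa [← conj_shift, conj_conj]

theorem exists_first_diff {a b : ℕ → Fin (m + 1)} (h : a ≠ b) :
    ∃ n, (∀ i < n, a i = b i) ∧ a n ≠ b n := by
  have hex : ∃ n, a n ≠ b n := Function.ne_iff.mp h
  classical
  exact ⟨Nat.find hex, fun i hi => not_not.mp (Nat.find_min hex hi), Nat.find_spec hex⟩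

/-- At the first difference the digits differ by at least 1, which the tails would have to make up.
The criterion keeps the tail of `a` less than 1 away from the relevant end of [0, m/(β-1)], so no
tail of `b` can do it. -/
theorem IsUniq.eq_of_val_eq {β : ℝ} (hβ : 1 < β) {a b : ℕ → Fin (m + 1)} (h : IsUniq β a)
    (hab : val β b = val β a) : b = a := by
  by_contra hne
  obtain ⟨n, hn, hd⟩ := exists_first_diff hne
  have key := val_sub_of_agree_succ hβ hn
  rw [hab, sub_self, mul_zero] at key
  have hb0 := val_nonneg hβ (shift (n + 1) b)
  have hb1 := val_le hβ (shift (n + 1) b)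
  rcases lt_or_gt_of_ne hd with h1 | h1
  · have := (h n).2 (lt_of_le_of_lt (Fin.zero_le _) h1)
    rw [val_conj hβ] at this
    have h2 : ((b n : ℕ) : ℝ) + 1 ≤ (a n : ℕ) := by exact_mod_cast h1
    linarith
  · have := (h n).1 (lt_of_lt_of_le h1 (Fin.le_last _))
    have h2 : ((a n : ℕ) : ℝ) + 1 ≤ (b n : ℕ) := by exact_mod_cast h1
    linarith

/-- If the tail were worth at least 1, the digit could be raised by one and the tail value minus 1
expanded again, which is possible because β ≤ m + 1. That is a second expansion. -/
theorem val_shift_lt_one_of_unique {β : ℝ} (hβ : 1 < β) (hβm : β ≤ m + 1) {a : ℕ → Fin (m + 1)}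
    (h : ∀ b : ℕ → Fin (m + 1), val β b = val β a → b = a) {n : ℕ} (hn : a n < Fin.last m) :
    val β (shift (n + 1) a) < 1 := by
  have h0 : (0 : ℝ) < β := by linarith
  by_contra! hge
  obtain ⟨b, hb⟩ := exists_val_eq (m := m) (x := val β (shift (n + 1) a) - 1) hβ hβm
    ⟨by linarith, by have := val_le hβ (shift (n + 1) a); linarith⟩
  have hlt : (a n : ℕ) + 1 < m + 1 := by rw [Fin.lt_def] at hn; simpa using hn
  let b' : ℕ → Fin (m + 1) := fun i =>
    if i < n then a i else if i = n then ⟨(a n : ℕ) + 1, hlt⟩ else b (i - (n + 1))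
  have hbn : ((b' n : ℕ)) = (a n : ℕ) + 1 := by simp [b']
  have hs : shift (n + 1) b' = b := by
    ext i
    have h1 : ¬ (n + 1 + i < n) := by omega
    have h2 : n + 1 + i ≠ n := by omega
    simp [b', h1, h2]
  have key := val_sub_of_agree_succ hβ (a := b') (b := a) (n := n) (fun i hi => by simp [b', hi])
  rw [hs, hb, hbn] at key
  have hz : β ^ (n + 1) * (val β b' - val β a) = 0 := by rw [key]; push_cast; ring
  have : val β b' - val β a = 0 := by
    rcases mul_eq_zero.mp hz with h | h
    · exact absurd h (by positivity)
    · exact h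
  have := h b' (by linarith)
  rw [this] at hbn
  omega

theorem isUniq_of_unique {β : ℝ} (hβ : 1 < β) (hβm : β ≤ m + 1) {a : ℕ → Fin (m + 1)}
    (h : ∀ b : ℕ → Fin (m + 1), val β b = val β a → b = a) : IsUniq β a := by
  intro n
  refine ⟨val_shift_lt_one_of_unique hβ hβm h, fun hn => ?_⟩
  rw [conj_shift]
  refine val_shift_lt_one_of_unique hβ hβm (fun b hb => ?_) ?_
  · rw [← h (BetaExpansion.conj b) (by rw [val_conj hβ, hb, val_conj hβ]; ring), conj_conj]
  · rw [conj_apply]; rw [Fin.lt_def] at *; simp at *; omega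

theorem encard_expansions_eq_one {β : ℝ} (hβ : 1 < β) {a : ℕ → Fin (m + 1)} (h : IsUniq β a) :
    (expansions m β (val β a)).encard = 1 := by
  rw [Set.encard_eq_one]
  refine ⟨a, Set.eq_singleton_iff_unique_mem.mpr ⟨(mem_expansions_iff hβ a).mpr rfl, fun b hb => ?_⟩⟩
  exact h.eq_of_val_eq hβ ((mem_expansions_iff hβ b).mp hb)

theorem IsUniq.val_mem_uniqueSet {β : ℝ} (hβ : 1 < β) {a : ℕ → Fin (m + 1)} (h : IsUniq β a) :
    val β a ∈ uniqueSet m β :=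
  ⟨⟨val_nonneg hβ a, val_le hβ a⟩, encard_expansions_eq_one hβ h⟩

theorem uniqueSet_eq_image {β : ℝ} (hβ : 1 < β) (hβm : β ≤ m + 1) :
    uniqueSet m β = val β '' {a : ℕ → Fin (m + 1) | IsUniq β a} := by
  ext x
  constructor
  · rintro ⟨-, hx⟩
    obtain ⟨a, ha⟩ := Set.encard_eq_one.mp hx
    have hax : val β a = x := (mem_expansions_iff hβ a).mp (by rw [ha]; rfl)
    refine ⟨a, isUniq_of_unique hβ hβm fun b hb => ?_, hax⟩
    have : b ∈ expansions m β x := (mem_expansions_iff hβ b).mpr (hb.trans hax)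
    rwa [ha] at this
  · rintro ⟨a, ha, rfl⟩
    exact ha.val_mem_uniqueSet hβ

theorem injOn_val_isUniq {β : ℝ} (hβ : 1 < β) :
    Set.InjOn (val β) {a : ℕ → Fin (m + 1) | IsUniq β a} :=
  fun _ _ _ hb h => hb.eq_of_val_eq hβ h

/-- A sequence all of whose tails, and their reflections, have values below `1`. -/
def IsCore (β : ℝ) (a : ℕ → Fin (m + 1)) : Prop :=
  ∀ n, val β (shift n a) < 1 ∧ val β (conj (shift n a)) < 1

theorem IsCore.isUniq {β : ℝ} {a : ℕ → Fin (m + 1)} (h : IsCore β a) : IsUniq β a :=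
  fun n => ⟨fun _ => (h (n + 1)).1, fun _ => (h (n + 1)).2⟩

theorem IsUniq.exists_forall_val_lt {β : ℝ} (hβ : 1 < β) (hβm : β ≤ m + 1)
    {a : ℕ → Fin (m + 1)} (h : IsUniq β a) (hne : ∃ n, a n < Fin.last m) :
    ∃ N, ∀ n ≥ N, val β (shift n a) < 1 := by
  obtain ⟨N, hN⟩ := hne
  refine ⟨N + 1, fun n hn => ?_⟩
  induction n, hn using Nat.le_induction with
  | base => exact (h N).1 hN
  | succ n hn ih =>
    -- After a digit m the next tail has value βv - m < β - m ≤ 1, so the bound persists even where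
    -- the criterion is silent.
    rcases (Fin.le_last (a n)).lt_or_eq with h1 | h1
    · exact (h n).1 h1
    · have := val_shift_succ hβ a n
      rw [h1, Fin.val_last] at this
      nlinarith

/-- A sequence satisfying the uniqueness criterion is constant `0`, constant `m`, or eventually in
the core. -/
theorem IsUniq.eventually_isCore {β : ℝ} (hβ : 1 < β) (hβm : β ≤ m + 1)
    {a : ℕ → Fin (m + 1)} (h : IsUniq β a) :
    a = (fun _ => Fin.last m) ∨ a = (fun _ => 0) ∨ ∃ N, IsCore β (shift N a) := by
  by_cases h1 : ∃ n, a n < Fin.last m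
  · by_cases h2 : ∃ n, 0 < a n
    · obtain ⟨N, hN⟩ := h.exists_forall_val_lt hβ hβm h1
      obtain ⟨N', hN'⟩ := h.conj.exists_forall_val_lt hβ hβm (by
        obtain ⟨n, hn⟩ := h2
        exact ⟨n, by rw [conj_apply]; rw [Fin.lt_def] at *; simp at *; omega⟩)
      refine Or.inr (Or.inr ⟨N + N', fun n => ⟨?_, ?_⟩⟩)
      · rw [shift_shift]; exact hN _ (by omega)
      · rw [shift_shift, conj_shift]; exact hN' _ (by omega)
    · right; left
      funext n
      exact le_antisymm (not_lt.mp fun hn => h2 ⟨n, hn⟩) (Fin.zero_le _)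
  · left
    funext n
    exact le_antisymm (Fin.le_last _) (not_lt.mp fun hn => h1 ⟨n, hn⟩)

/-! ### The Thue–Morse sequence. -/

theorem thueMorse_eq_zero_or_one (n : ℕ) : thueMorse n = 0 ∨ thueMorse n = 1 := by
  induction n using Nat.strong_induction_on with
  | _ n ih =>
    obtain ⟨j, rfl | rfl⟩ := n.even_or_odd'
    · rcases Nat.eq_zero_or_pos j with rfl | hj
      · exact Or.inl thueMorse_zero
      · rw [thueMorse_two_mul]; exact ih j (by omega)
    · rw [thueMorse_two_mul_add_one]
      rcases ih j (by omega) with h | h <;> simp [h]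

theorem thueMorse_two_pow_add (n : ℕ) :
    ∀ i < 2 ^ n, thueMorse (2 ^ n + i) = 1 - thueMorse i := by
  induction n with
  | zero =>
    intro i hi
    obtain rfl : i = 0 := by simpa using hi
    simpa using thueMorse_two_mul_add_one 0
  | succ n ih =>
    intro i hi
    rw [pow_succ] at hi ⊢
    obtain ⟨j, rfl | rfl⟩ := i.even_or_odd'
    · rw [show 2 ^ n * 2 + 2 * j = 2 * (2 ^ n + j) by ring, thueMorse_two_mul, thueMorse_two_mul,
        ih j (by omega)]
    · rw [show 2 ^ n * 2 + (2 * j + 1) = 2 * (2 ^ n + j) + 1 by ring, thueMorse_two_mul_add_one,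
        thueMorse_two_mul_add_one, ih j (by omega)]

theorem thueMorse_two_pow (n : ℕ) : thueMorse (2 ^ n) = 1 := by
  have := thueMorse_two_pow_add n 0 (by positivity)
  simpa [thueMorse_zero] using this

/-- The Thue–Morse sequence is not eventually periodic. -/
theorem thueMorse_not_periodic {p : ℕ} (hp : 0 < p) (N : ℕ) :
    ∃ n ≥ N, thueMorse (n + p) ≠ thueMorse n := by
  induction p using Nat.strong_induction_on generalizing N with
  | _ p ih =>
    by_contra! h
    obtain ⟨q, rfl | rfl⟩ := p.even_or_odd'
    · obtain ⟨n, hn, hne⟩ := ih q (by omega) (by omega) N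
      apply hne
      have := h (2 * n) (by omega)
      rwa [show 2 * n + 2 * q = 2 * (n + q) by ring, thueMorse_two_mul, thueMorse_two_mul] at this
    -- An odd period carries the pair (n, n+1) with n odd to a pair (2j, 2j+1), so the sequence
    -- would alternate at every step. But the alternation at 2N and 2N+1 gives λ_{N+1} = λ_N,
    -- against the alternation at N.
    · have alt : ∀ n ≥ N, thueMorse (n + 1) = 1 - thueMorse n := by
        intro n hn
        obtain ⟨j, rfl | rfl⟩ := n.even_or_odd'
        · rw [thueMorse_two_mul_add_one, thueMorse_two_mul]
        · have h1 := h (2 * j + 1) hn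
          have h2 := h (2 * j + 1 + 1) (by omega)
          rw [show 2 * j + 1 + (2 * q + 1) = 2 * (j + q + 1) by ring, thueMorse_two_mul] at h1
          rw [show 2 * j + 1 + 1 + (2 * q + 1) = 2 * (j + q + 1) + 1 by ring,
            thueMorse_two_mul_add_one] at h2
          rw [← h2, ← h1]
      have h1 := alt N le_rfl
      have h2 := alt (2 * N) (by omega)
      have h3 := alt (2 * N + 1) (by omega)
      rw [show 2 * N + 1 + 1 = 2 * (N + 1) by ring, h2, thueMorse_two_mul, thueMorse_two_mul] at h3
      rcases thueMorse_eq_zero_or_one N with h4 | h4 <;> rw [h4] at h1 h3 <;> omega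

/-! ### The critical sequence and its doubling structure. -/

/-- The sequence `λ₁(m) λ₂(m) …`, as a sequence of digits. -/
def critSeq (m : ℕ) : ℕ → Fin (m + 1) := fun i => Fin.ofNat (m + 1) (criticalDigit m (i + 1)).toNat

theorem criticalDigit_bounds (hm : 2 ≤ m) (i : ℕ) :
    0 ≤ criticalDigit m i ∧ criticalDigit m i ≤ m := by
  unfold criticalDigit
  rcases thueMorse_eq_zero_or_one i with h | h <;>
  rcases thueMorse_eq_zero_or_one (i - 1) with h' | h' <;>
  rw [h, h'] <;> split_ifs <;> omega

theorem critSeq_val (hm : 2 ≤ m) (i : ℕ) :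
    ((critSeq m i : ℕ) : ℤ) = criticalDigit m (i + 1) := by
  have h := criticalDigit_bounds hm (i + 1)
  simp only [critSeq, Fin.val_ofNat]
  rw [Nat.mod_eq_of_lt (by omega)]
  omega

theorem critSeq_zero (hm : 2 ≤ m) : (critSeq m 0 : ℕ) = m / 2 + 1 := by
  have h := critSeq_val hm 0
  have h1 : thueMorse 1 = 1 := thueMorse_two_pow 0
  simp only [criticalDigit, zero_add, h1, Nat.sub_self, thueMorse_zero] at h
  split_ifs at h <;> omega

/-- The second block of length 2^n reflects the first. The last digit is excluded: digits are
indexed from 0 but `criticalDigit` from 1, so that digit already involves λ at 2^(n+1), and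
`critSeq_last` shows it to be one more than the reflection. -/
theorem critSeq_add (hm : 2 ≤ m) {n i : ℕ} (hi : i + 1 < 2 ^ n) :
    critSeq m (2 ^ n + i) = Fin.rev (critSeq m i) := by
  have h1 := critSeq_val hm (2 ^ n + i)
  have h2 := critSeq_val hm i
  have h3 := thueMorse_two_pow_add n (i + 1) hi
  have h4 := thueMorse_two_pow_add n i (by omega)
  have h5 := (critSeq m i).2
  simp only [criticalDigit, ← add_assoc, Nat.add_sub_cancel] at h1 h2 h3
  rw [h3, h4] at h1
  ext
  rw [Fin.val_rev]
  split_ifs at h1 h2 with he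
  · obtain ⟨k, rfl⟩ := he; omega
  · have := Nat.odd_iff.mp (Nat.not_even_iff_odd.mp he)
    omega

theorem critSeq_last (hm : 2 ≤ m) (n : ℕ) :
    (critSeq m (2 ^ (n + 1) - 1) : ℕ) + (critSeq m (2 ^ n - 1) : ℕ) = m + 1 := by
  have h1 := critSeq_val hm (2 ^ (n + 1) - 1)
  have h2 := critSeq_val hm (2 ^ n - 1)
  have hp : 0 < 2 ^ n := by positivity
  have hp' : 2 ^ (n + 1) = 2 ^ n + 2 ^ n := by ring
  have h3 := thueMorse_two_pow_add n (2 ^ n - 1) (by omega)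
  have h4 := thueMorse_two_pow n
  have h5 := thueMorse_two_pow (n + 1)
  rw [show 2 ^ n + (2 ^ n - 1) = 2 ^ (n + 1) - 1 by omega] at h3
  rw [show 2 ^ (n + 1) - 1 + 1 = 2 ^ (n + 1) by omega] at h1
  rw [show 2 ^ n - 1 + 1 = 2 ^ n by omega] at h2
  simp only [criticalDigit, h4, h5, h3] at h1 h2
  split_ifs at h1 h2 with he
  · obtain ⟨k, rfl⟩ := he; omega
  · have := Nat.odd_iff.mp (Nat.not_even_iff_odd.mp he)
    omega

theorem critSeq_one (hm : 2 ≤ m) : (critSeq m 1 : ℕ) = m - m / 2 := by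
  have h1 := critSeq_last hm 0
  have h2 := critSeq_zero hm
  simp only [zero_add, pow_one, pow_zero, Nat.sub_self, show 2 - 1 = 1 from rfl] at h1
  omega

/-! ### Lexicographic extremality of the critical sequence. -/

/-- Lexicographic comparison `a ≤ b` of the first `N` digits. -/
def LexLe (N : ℕ) (a b : ℕ → Fin (m + 1)) : Prop :=
  ∀ j < N, (∀ i < j, a i = b i) → a j ≤ b j

/-- Strict lexicographic comparison `a < b` of the first `N` digits. -/
def LexLt (N : ℕ) (a b : ℕ → Fin (m + 1)) : Prop :=
  ∃ j < N, (∀ i < j, a i = b i) ∧ a j < b j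

theorem LexLe.mono {M N : ℕ} {a b : ℕ → Fin (m + 1)} (h : LexLe N a b) (hM : M ≤ N) :
    LexLe M a b := fun j hj => h j (by omega)

theorem LexLe.conj {N : ℕ} {a b : ℕ → Fin (m + 1)} (h : LexLe N a b) :
    LexLe N (conj b) (conj a) := fun j hj hij =>
  Fin.rev_le_rev.mpr (h j hj fun i hi => (Fin.rev_injective (hij i hi)).symm)

theorem LexLt.le {N : ℕ} {a b : ℕ → Fin (m + 1)} (h : LexLt N a b) : LexLe N a b := by
  obtain ⟨l, hl, hagree, hlt⟩ := h
  intro j hj hij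
  rcases lt_trichotomy j l with h | rfl | h
  · exact (hagree j h).le
  · exact hlt.le
  · exact absurd (hij l h) hlt.ne

/-- Induction by doubling: the second block is the reflected first block with its last digit raised
by one, so each half of the claim for the second block comes from the other half for the first. The
reflected inequality must be strict because raising a digit turns < only into ≤. -/
theorem critSeq_admissible (hm : 2 ≤ m) (n : ℕ) : ∀ i < 2 ^ n,
    LexLe (2 ^ n - i) (shift i (critSeq m)) (critSeq m) ∧
    LexLt (2 ^ n - i) (conj (critSeq m)) (shift i (critSeq m)) := by
  induction n with
  | zero =>
    intro i hi
    obtain rfl : i = 0 := by simpa using hi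
    refine ⟨fun j _ _ => by simp, 0, by simp, by simp, ?_⟩
    have := critSeq_zero hm
    rw [Fin.lt_def, conj_apply, Fin.val_rev, shift_apply]
    simp only [add_zero]
    omega
  | succ n ih =>
    have hq : 0 < 2 ^ n := by positivity
    have hrec : ∀ i, i + 1 < 2 ^ n → critSeq m (2 ^ n + i) = Fin.rev (critSeq m i) :=
      fun i hi => critSeq_add hm hi
    have hlast := critSeq_last hm n
    rw [pow_succ] at *
    set c := critSeq m with hc
    set q := 2 ^ n with hqdef
    rw [show q * 2 - 1 = q + (q - 1) by omega] at hlast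
    clear_value c q
    intro i hi
    rcases lt_or_ge i q with hiq | hiq
    · constructor
      · intro j hj hij
        simp only [shift_apply] at hij ⊢
        rcases Nat.eq_zero_or_pos i with rfl | hi0
        · simp
        rcases lt_or_ge j (q - i) with hjq | hjq
        · exact (ih i hiq).1 j hjq hij
        -- The comparison has crossed into the second block: reflected prefix against the tail of
        -- the prefix from q - i. The strict half at q - i decides it before the raised digit is
        -- reached.
        obtain ⟨x, rfl⟩ := Nat.exists_eq_add_of_le hjq
        obtain ⟨l, hl, hagree, hlt⟩ := (ih (q - i) (by omega)).2
        simp only [shift_apply, conj_apply] at hagree hlt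
        have e : ∀ y, i + (q - i + y) = q + y := fun y => by omega
        rw [e]
        rcases lt_trichotomy x l with h | rfl | h
        · rw [hrec x (by omega), hagree x h]
        · rw [hrec x (by omega)]; exact hlt.le
        · have := hij (q - i + l) (by omega)
          rw [e, hrec l (by omega)] at this
          exact absurd this hlt.ne
      · obtain ⟨l, hl, h⟩ := (ih i hiq).2
        exact ⟨l, by omega, h⟩
    · obtain ⟨i, rfl⟩ := Nat.exists_eq_add_of_le hiq
      have hi' : i < q := by omega
      have e : q * 2 - (q + i) = q - i := by omega
      rw [e]
      constructor
      · obtain ⟨l, hl, hagree, hlt⟩ := (ih i hi').2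
        intro j hj hij
        simp only [shift_apply, conj_apply, add_assoc] at hagree hlt hij ⊢
        rcases lt_trichotomy j l with h | rfl | h
        · rw [hrec (i + j) (by omega), ← hagree j h, Fin.rev_rev]
        · rcases Nat.lt_or_ge (i + j + 1) q with h | h
          · rw [hrec (i + j) h, ← Fin.rev_rev (c j)]
            exact (Fin.rev_lt_rev.mpr hlt).le
          · have hij' : i + j = q - 1 := by omega
            rw [hij'] at hlt ⊢
            rw [Fin.lt_def, Fin.val_rev] at hlt
            rw [Fin.le_def]
            omega
        · have := hij l h
          rw [hrec (i + l) (by omega)] at this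
          rw [← this, Fin.rev_rev] at hlt
          exact absurd hlt (lt_irrefl _)
      · have hle := (ih i hi').1
        -- If the tail of the first block copies the prefix up to the end, the raised last digit
        -- makes the inequality strict; otherwise the first disagreement does.
        by_cases hagree : ∀ x < q - i - 1, c (i + x) = c x
        · refine ⟨q - i - 1, by omega, fun x hx => ?_, ?_⟩
          · simp only [shift_apply, conj_apply, add_assoc]
            rw [hrec (i + x) (by omega), hagree x hx]
          · have := hle (q - i - 1) (by omega) hagree
            simp only [shift_apply, conj_apply, add_assoc] at this ⊢
            rw [show i + (q - i - 1) = q - 1 by omega] at *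
            rw [Fin.le_def] at this
            rw [Fin.lt_def, Fin.val_rev]
            omega
        · push Not at hagree
          classical
          set l := Nat.find hagree with hl
          obtain ⟨hl1, hl2⟩ := Nat.find_spec hagree
          have hmin : ∀ x < l, c (i + x) = c x := fun x hx => by
            have := Nat.find_min hagree hx
            push Not at this
            exact this (by omega)
          refine ⟨l, by omega, fun x hx => ?_, ?_⟩
          · simp only [shift_apply, conj_apply, add_assoc]
            rw [hrec (i + x) (by omega), hmin x hx]
          · have := hle l (by omega) hmin
            simp only [shift_apply, conj_apply, add_assoc] at this ⊢
            rw [hrec (i + l) (by omega), Fin.rev_lt_rev]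
            exact lt_of_le_of_ne this hl2

theorem critSeq_shift_le (hm : 2 ≤ m) (i N : ℕ) :
    LexLe N (shift i (critSeq m)) (critSeq m) := by
  have := Nat.lt_two_pow_self (n := i + N)
  exact ((critSeq_admissible hm (i + N) i (by omega)).1).mono (by omega)

theorem critSeq_conj_le (hm : 2 ≤ m) (i N : ℕ) :
    LexLe N (conj (critSeq m)) (shift i (critSeq m)) := by
  have := Nat.lt_two_pow_self (n := i + N)
  exact ((critSeq_admissible hm (i + N) i (by omega)).2.le).mono (by omega)

/-! ### Lexicographic order against the order of values. -/

/-- If the first `M` digits of every tail of `a` are at most those of a sequence of value at most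
`1`, then the tails of `a` have value at most about `1`. -/
theorem val_shift_le_of_lexLe {β : ℝ} (hβ : 1 < β) {a c : ℕ → Fin (m + 1)} (hc : val β c ≤ 1)
    {M : ℕ} (h : ∀ n, LexLe M (shift n a) c) (n : ℕ) :
    val β (shift n a) ≤ 1 + m / (β - 1) / β ^ M := by
  have h0 : (0 : ℝ) < β := by linarith
  have h1 : (0 : ℝ) < β - 1 := by linarith
  -- The error improves by a factor β with each k. At the first disagreement with `c` the digit
  -- drops by at least 1, which absorbs the main term 1 of the next tail, and its error is divided
  -- by at least β. With no disagreement the error is at most m/(β-1)/β^M.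
  suffices H : ∀ k ≤ M, ∀ n, val β (shift n a) ≤ 1 + m / (β - 1) / β ^ k from H M le_rfl n
  intro k
  induction k with
  | zero => intro _ n; have := val_le hβ (shift n a); simp; linarith
  | succ k ih =>
    intro hk n
    by_cases hag : ∀ i < M, shift n a i = c i
    · have h2 := val_sub_of_agree hβ hag
      have h3 := val_le hβ (shift M (shift n a))
      have h4 := val_nonneg hβ (shift M c)
      have h5 : (val β (shift M (shift n a)) - val β (shift M c)) / β ^ M ≤
          m / (β - 1) / β ^ (k + 1) := by
        have : (0 : ℝ) ≤ m / (β - 1) := by positivity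
        have : β ^ (k + 1) ≤ β ^ M := pow_le_pow_right₀ hβ.le hk
        gcongr
        linarith
      linarith
    · push Not at hag
      classical
      set l := Nat.find hag with hl
      obtain ⟨hl1, hl2⟩ := Nat.find_spec hag
      have hmin : ∀ x < l, shift n a x = c x := fun x hx => by
        have := Nat.find_min hag hx
        push Not at this
        exact this (by omega)
      have hlt : shift n a l < c l := lt_of_le_of_ne (h n l hl1 hmin) hl2
      have h2 : ((shift n a l : ℕ) : ℝ) + 1 ≤ (c l : ℕ) := by exact_mod_cast hlt
      have key := val_sub_of_agree_succ hβ hmin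
      have h3 := ih (by omega) (n + (l + 1))
      rw [← shift_shift] at h3
      have h4 := val_nonneg hβ (shift (l + 1) c)
      have h5 : β ^ (l + 1) * (val β (shift n a) - val β c) ≤ m / (β - 1) / β ^ k := by linarith
      have h6 : β ≤ β ^ (l + 1) := le_self_pow₀ hβ.le (by omega)
      have h7 : val β (shift n a) - val β c ≤ m / (β - 1) / β ^ (k + 1) := by
        rw [pow_succ, ← div_div, le_div_iff₀ h0]
        rcases le_or_gt (val β (shift n a) - val β c) 0 with h8 | h8
        · have : (0 : ℝ) ≤ m / (β - 1) / β ^ k := by positivity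
          nlinarith
        · nlinarith
      linarith

theorem val_shift_le_one {β : ℝ} (hβ : 1 < β) {a c : ℕ → Fin (m + 1)} (hc : val β c ≤ 1)
    (h : ∀ n N, LexLe N (shift n a) c) (n : ℕ) : val β (shift n a) ≤ 1 := by
  have h3 : Tendsto (fun M : ℕ => 1 + m / (β - 1) * (β⁻¹) ^ M) atTop (𝓝 (1 + m / (β - 1) * 0)) :=
    ((tendsto_pow_atTop_nhds_zero_of_lt_one (inv_nonneg.mpr (by linarith))
      (inv_lt_one_of_one_lt₀ hβ)).const_mul _).const_add _
  rw [mul_zero, add_zero] at h3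
  refine ge_of_tendsto' h3 fun M => ?_
  rw [inv_pow, ← div_eq_mul_inv]
  exact val_shift_le_of_lexLe hβ hc (fun n => h n M) n

/-- A sequence all of whose tails, and their reflections, have values at most `1`. -/
def IsClosedCore (β : ℝ) (a : ℕ → Fin (m + 1)) : Prop :=
  ∀ n, val β (shift n a) ≤ 1 ∧ val β (conj (shift n a)) ≤ 1

theorem IsClosedCore.conj {β : ℝ} {a : ℕ → Fin (m + 1)} (h : IsClosedCore β a) :
    IsClosedCore β (conj a) :=
  fun n => ⟨(h n).2, by rw [← conj_shift, conj_conj]; exact (h n).1⟩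

theorem IsClosedCore.shift {β : ℝ} {a : ℕ → Fin (m + 1)} (h : IsClosedCore β a) (k : ℕ) :
    IsClosedCore β (shift k a) :=
  fun n => by rw [shift_shift]; exact h _

theorem isClosedCore_critSeq (hm : 2 ≤ m) {β : ℝ} (hβ : 1 < β) (hc : val β (critSeq m) ≤ 1) :
    IsClosedCore β (critSeq m) := fun n =>
  ⟨val_shift_le_one hβ hc (critSeq_shift_le hm) n, by
    rw [conj_shift]
    refine val_shift_le_one hβ hc (fun i N => ?_) n
    simpa [conj_shift] using (critSeq_conj_le hm i N).conj⟩

/-- On the closed core the order of the values is the lexicographic one. -/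
theorem IsClosedCore.lexLe {β : ℝ} (hβ : 1 < β) (hβm : β < m + 1) {a b : ℕ → Fin (m + 1)}
    (ha : IsClosedCore β a) (hb : IsClosedCore β b) (hab : val β a ≤ val β b) (N : ℕ) :
    LexLe N a b := by
  intro j _ hij
  by_contra! hlt
  have h0 : (0 : ℝ) < β := by linarith
  have h2 : ((b j : ℕ) : ℝ) + 1 ≤ (a j : ℕ) := by exact_mod_cast hlt
  have key := val_sub_of_agree_succ hβ hij
  have h3 := (ha (j + 1)).2
  have h4 := (hb (j + 1)).1
  rw [val_conj hβ] at h3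
  have hL : 1 < (m : ℝ) / (β - 1) := by rw [lt_div_iff₀ (by linarith)]; linarith
  have h5 : 0 < β ^ (j + 1) * (val β a - val β b) := by rw [key]; linarith
  have := pos_of_mul_pos_right h5 (by positivity)
  linarith

theorem eq_of_lexLe {a b : ℕ → Fin (m + 1)} (h : ∀ N, LexLe N a b) (h' : ∀ N, LexLe N b a) :
    a = b := by
  by_contra hne
  obtain ⟨n, hn, hd⟩ := exists_first_diff hne
  exact hd (le_antisymm (h (n + 1) n (by omega) hn)
    (h' (n + 1) n (by omega) fun i hi => (hn i hi).symm))

theorem IsClosedCore.eq_of_val_eq {β : ℝ} (hβ : 1 < β) (hβm : β < m + 1) {a b : ℕ → Fin (m + 1)}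
    (ha : IsClosedCore β a) (hb : IsClosedCore β b) (hab : val β a = val β b) : a = b :=
  eq_of_lexLe (ha.lexLe hβ hβm hb hab.le) (hb.lexLe hβ hβm ha hab.ge)

theorem continuous_val {β : ℝ} (hβ : 1 < β) :
    Continuous (val β : (ℕ → Fin (m + 1)) → ℝ) := by
  have h0 : (0 : ℝ) < β := by linarith
  refine continuous_tsum (u := fun i : ℕ => (m : ℝ) / β ^ (i + 1)) (fun i => ?_)
    (hasSum_const_digit hβ (m : ℝ)).summable (fun i a => ?_)
  · exact (continuous_of_discreteTopology (f := fun d : Fin (m + 1) =>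
      ((d : ℕ) : ℝ) / β ^ (i + 1))).comp (continuous_apply i)
  · rw [Real.norm_of_nonneg (by positivity)]
    have := digit_le a i
    gcongr

/-! ### Cantor sets of expansions below the golden ratio. -/

/-- A set of sequences without isolated points has a Cantor set in every closed superset. -/
theorem exists_cantor_injection {A C : Set (ℕ → Fin (m + 1))} (hne : A.Nonempty)
    (hA : ∀ a ∈ A, ∀ n, ∃ b ∈ A, (∀ i < n, b i = a i) ∧ b ≠ a) (hC : IsClosed C) (hAC : A ⊆ C) :
    ∃ f : (ℕ → Bool) → ℕ → Fin (m + 1), Function.Injective f ∧ ∀ x, f x ∈ C := by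
  have hpre : Preperfect A := by
    rw [preperfect_iff_nhds]
    intro a ha U hU
    obtain ⟨V, ⟨x, n, rfl⟩, haV, hVU⟩ :=
      (PiNat.isTopologicalBasis_cylinders (fun _ : ℕ => Fin (m + 1))).mem_nhds_iff.mp hU
    obtain ⟨b, hb, hab, hne⟩ := hA a ha n
    refine ⟨b, ⟨hVU ?_, hb⟩, hne⟩
    rw [PiNat.mem_cylinder_iff] at haV ⊢
    exact fun i hi => (hab i hi).trans (haV i hi)
  let := TopologicalSpace.upgradeIsCompletelyMetrizable (ℕ → Fin (m + 1))
  obtain ⟨f, hf, -, hinj⟩ := hpre.perfect_closure.exists_nat_bool_injection hne.closure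
  exact ⟨f, hinj, fun x => closure_minimal hAC hC (hf ⟨x, rfl⟩)⟩

/-- The first `n` digits of `a`, followed by `b`. -/
def splice (n : ℕ) (a b : ℕ → Fin (m + 1)) : ℕ → Fin (m + 1) :=
  fun i => if i < n then a i else b (i - n)

theorem splice_of_lt {n i : ℕ} (h : i < n) (a b : ℕ → Fin (m + 1)) : splice n a b i = a i := by
  simp [splice, h]

theorem shift_splice (n : ℕ) (a b : ℕ → Fin (m + 1)) : shift n (splice n a b) = b := by
  ext i; simp [splice]

theorem val_shift_splice {β : ℝ} (hβ : 1 < β) {n k : ℕ} (hk : k ≤ n) {a b : ℕ → Fin (m + 1)}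
    (h : val β b = val β (shift n a)) : val β (shift k (splice n a b)) = val β (shift k a) := by
  obtain ⟨l, rfl⟩ := Nat.exists_eq_add_of_le hk
  have key := val_sub_of_agree hβ (a := shift k (splice (k + l) a b)) (b := shift k a) (n := l)
    (fun i hi => by rw [shift_apply, shift_apply, splice_of_lt (by omega)])
  rw [shift_shift, shift_shift, shift_splice, h, sub_self, zero_div] at key
  linarith

/-- The expansions of `x` all of whose tails have values in the interior of the interval. -/
def interiorExpansions (m : ℕ) (β x : ℝ) : Set (ℕ → Fin (m + 1)) :=
  {a | val β a = x ∧ ∀ n, val β (shift n a) ∈ Set.Ioo 0 ((m : ℝ) / (β - 1))}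

/-- Branching at a late tail gives another expansion agreeing with the first for as long as desired,
so interior expansions are never isolated. Tails must stay interior because the endpoints have only
constant expansions, where branching ends. -/
theorem not_countable_expansions {β x : ℝ} (hβ : 1 < β)
    (hx : x ∈ Set.Ioo 0 ((m : ℝ) / (β - 1)))
    (h : ∀ y ∈ Set.Ioo 0 ((m : ℝ) / (β - 1)), (interiorExpansions m β y).Nontrivial) :
    ¬ (expansions m β x).Countable := by
  have hcl : IsClosed (expansions m β x) := by
    have : expansions m β x = val β ⁻¹' {x} := by ext a; simp [mem_expansions_iff hβ]
    rw [this]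
    exact isClosed_singleton.preimage (continuous_val hβ)
  have hiso : ∀ a ∈ interiorExpansions m β x, ∀ n, ∃ b ∈ interiorExpansions m β x,
      (∀ i < n, b i = a i) ∧ b ≠ a := by
    intro a ha n
    obtain ⟨b, ⟨hb1, hb2⟩, hne⟩ := (h _ (ha.2 n)).exists_ne (shift n a)
    refine ⟨splice n a b, ⟨?_, fun k => ?_⟩, fun i hi => splice_of_lt hi a b, fun he => hne ?_⟩
    · have := val_shift_splice hβ (Nat.zero_le n) hb1
      rw [shift_zero, shift_zero] at this
      rw [this, ha.1]
    · rcases le_or_gt k n with hk | hk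
      · rw [val_shift_splice hβ hk hb1]; exact ha.2 k
      · obtain ⟨l, rfl⟩ := Nat.exists_eq_add_of_lt hk
        rw [add_assoc, ← shift_shift, shift_splice]
        exact hb2 _
    · rw [← shift_splice n a b, he]
  obtain ⟨f, hinj, hf⟩ := exists_cantor_injection (h x hx).nonempty hiso hcl
    (fun a ha => (mem_expansions_iff hβ a).mpr ha.1)
  intro hcount
  have h1 : (Set.univ : Set (ℕ → Bool)).Countable :=
    Set.MapsTo.countable_of_injOn (f := f) (fun x _ => hf x) hinj.injOn hcount
  rw [Set.countable_univ_iff] at h1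
  have h2 := Cardinal.mk_le_aleph0_iff.mpr h1
  simp only [Cardinal.mk_pi, Cardinal.mk_bool, Cardinal.prod_const] at h2
  simp at h2
  exact absurd h2 (not_le.mpr Cardinal.aleph0_lt_continuum)

/-- The sequence `d a₀ a₁ …`. -/
def cons (d : Fin (m + 1)) (a : ℕ → Fin (m + 1)) : ℕ → Fin (m + 1)
  | 0 => d
  | i + 1 => a i

theorem shift_succ_cons (d : Fin (m + 1)) (a : ℕ → Fin (m + 1)) (n : ℕ) :
    shift (n + 1) (cons d a) = shift n a := by
  funext i
  rw [shift_apply, show n + 1 + i = (n + i) + 1 by ring]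
  rfl

theorem cons_mem_interiorExpansions {β y : ℝ} (hβ : 1 < β) {d : Fin (m + 1)}
    {a : ℕ → Fin (m + 1)} (hy : y ∈ Set.Ioo 0 ((m : ℝ) / (β - 1)))
    (ha : a ∈ interiorExpansions m β (β * y - (d : ℕ))) :
    cons d a ∈ interiorExpansions m β y := by
  have hv : val β (cons d a) = y := by
    have h := val_succ hβ (cons d a)
    rw [shift_succ_cons, shift_zero, ha.1, show cons d a 0 = d from rfl] at h
    have : β * val β (cons d a) = β * y := by linarith
    exact mul_left_cancel₀ (by linarith) this
  refine ⟨hv, fun n => ?_⟩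
  cases n with
  | zero => rw [shift_zero, hv]; exact hy
  | succ n => rw [shift_succ_cons]; exact ha.2 n

theorem nontrivial_of_step {β y : ℝ} (hβ : 1 < β) (d : Fin (m + 1))
    (hy : y ∈ Set.Ioo 0 ((m : ℝ) / (β - 1)))
    (h : (interiorExpansions m β (β * y - (d : ℕ))).Nontrivial) :
    (interiorExpansions m β y).Nontrivial := by
  obtain ⟨a, ha, b, hb, hab⟩ := h
  refine ⟨_, cons_mem_interiorExpansions hβ hy ha, _, cons_mem_interiorExpansions hβ hy hb,
    fun he => hab ?_⟩
  rw [← shift_zero a, ← shift_succ_cons d a 0, he, shift_succ_cons, shift_zero]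

theorem nonempty_interiorExpansions {β y : ℝ} (hβ : 1 < β) (hL : 1 < (m : ℝ) / (β - 1))
    (hy : y ∈ Set.Ioo 0 ((m : ℝ) / (β - 1))) : (interiorExpansions m β y).Nonempty := by
  have h1 : 0 < β - 1 := by linarith
  have hL' : (m : ℝ) / (β - 1) * (β - 1) = m := by field_simp
  rw [interiorExpansions]
  set L := (m : ℝ) / (β - 1)
  have step : ∀ y ∈ Set.Ioo 0 L, ∃ d : Fin (m + 1), β * y - (d : ℕ) ∈ Set.Ioo 0 L := by
    rintro y ⟨hy0, hy1⟩
    have hb : 0 < β * y := by positivity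
    rcases lt_or_ge (m : ℝ) (β * y) with h | h
    · refine ⟨Fin.last m, ?_, ?_⟩
      · simpa using h
      · simp only [Fin.val_last]; nlinarith
    -- The digit is the ceiling minus one, not the floor: the remainder lies in (0, 1] and so avoids
    -- the endpoint 0.
    · have hc := Nat.ceil_pos.mpr hb
      have hc' := Nat.ceil_lt_add_one hb.le
      have hlt : ⌈β * y⌉₊ - 1 < m + 1 := by
        have : ⌈β * y⌉₊ ≤ m := Nat.ceil_le.mpr h
        omega
      refine ⟨⟨⌈β * y⌉₊ - 1, hlt⟩, ?_, ?_⟩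
      · simp only [Nat.cast_sub (show 1 ≤ ⌈β * y⌉₊ from hc), Nat.cast_one]; linarith
      · have := Nat.le_ceil (β * y)
        simp only [Nat.cast_sub (show 1 ≤ ⌈β * y⌉₊ from hc), Nat.cast_one]; linarith
  obtain ⟨a, ha, hn⟩ := exists_expansion hβ (C := L)
    (fun y hy => by rw [abs_of_pos hy.1]; exact hy.2.le) step hy
  exact ⟨a, ha, hn⟩

/-- A point where both digits `d` and `d + 1` lead to interior points. -/
def Branches (m : ℕ) (β y : ℝ) : Prop :=
  ∃ d : ℕ, d + 1 ≤ m ∧ (d : ℝ) + 1 < β * y ∧ β * y - d < (m : ℝ) / (β - 1)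

theorem Branches.nontrivial {β y : ℝ} (hβ : 1 < β) (hL : 1 < (m : ℝ) / (β - 1))
    (hy : y ∈ Set.Ioo 0 ((m : ℝ) / (β - 1))) (h : Branches m β y) :
    (interiorExpansions m β y).Nontrivial := by
  obtain ⟨d, hd, h1, h2⟩ := h
  obtain ⟨a, ha⟩ := nonempty_interiorExpansions (y := β * y - ((⟨d, by omega⟩ : Fin (m + 1)) : ℕ))
    hβ hL ⟨by simp only; linarith, by simp only; linarith⟩
  obtain ⟨b, hb⟩ := nonempty_interiorExpansions
    (y := β * y - ((⟨d + 1, by omega⟩ : Fin (m + 1)) : ℕ))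
    hβ hL ⟨by push_cast; linarith, by push_cast; linarith⟩
  refine ⟨_, cons_mem_interiorExpansions hβ hy ha, _, cons_mem_interiorExpansions hβ hy hb,
    fun he => ?_⟩
  have := congrFun he 0
  simp [cons] at this

/-- With L = m/(β-1), a point of (1/β, L - 1/β) either branches at once or moves in one step into [L
- 1, 1], where `hJ` applies. A point near an end is first pushed away from it by digits 0 or m; `h1`
keeps the digit 0 from overshooting into the other end zone. -/
theorem nontrivial_interiorExpansions {β : ℝ} (hβ : 1 < β)
    (h1 : 1 < β * ((m : ℝ) / (β - 1) - 1))
    (hJ : ∀ z, (m : ℝ) / (β - 1) - 1 ≤ z → z ≤ 1 → Branches m β z) {y : ℝ}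
    (hy : y ∈ Set.Ioo 0 ((m : ℝ) / (β - 1))) : (interiorExpansions m β y).Nontrivial := by
  have h0 : 0 < β := by linarith
  have h01 : 0 < β - 1 := by linarith
  have hL : 1 < (m : ℝ) / (β - 1) := by
    have := pos_of_mul_pos_right (zero_lt_one.trans h1) h0.le
    linarith
  have hL' : (m : ℝ) / (β - 1) * β = m / (β - 1) + m := by field_simp; ring
  have hbr := fun y hy h => Branches.nontrivial (m := m) (y := y) hβ hL hy h
  have hst := fun y d hy h => nontrivial_of_step (m := m) (y := y) hβ d hy h
  set L := (m : ℝ) / (β - 1)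
  have mid : ∀ y ∈ Set.Ioo 0 L, 1 < β * y → 1 < β * (L - y) →
      (interiorExpansions m β y).Nontrivial := by
    intro y hy hy1 hy2
    have hlt : 1 < ⌈β * y⌉₊ := Nat.lt_ceil.mpr (by exact_mod_cast hy1)
    obtain ⟨p, hp⟩ : ∃ p, ⌈β * y⌉₊ = p + 2 := ⟨⌈β * y⌉₊ - 2, by omega⟩
    have hp1 : ((p + 1 : ℕ) : ℝ) < β * y := Nat.lt_ceil.mp (by omega)
    have hp2 : β * y ≤ ((p + 2 : ℕ) : ℝ) := Nat.ceil_le.mp hp.le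
    push_cast at hp1 hp2
    rcases Nat.lt_or_ge m (p + 1) with hm | hm
    · have hm' : (m : ℝ) ≤ p := by exact_mod_cast Nat.lt_succ_iff.mp hm
      have hm1 : 1 ≤ m := by
        by_contra hm0
        have : (m : ℝ) = 0 := by exact_mod_cast (by omega : m = 0)
        simp only [L, this, zero_div] at hL
        linarith
      refine hbr y hy ⟨m - 1, by omega, ?_, ?_⟩
      · rw [Nat.cast_sub hm1]; push_cast; linarith
      · rw [Nat.cast_sub hm1]; push_cast; linarith
    · rcases lt_or_ge (β * y - p) L with h | h
      · exact hbr y hy ⟨p, hm, hp1, h⟩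
      · have hz := hJ (β * y - ((⟨p + 1, by omega⟩ : Fin (m + 1)) : ℕ))
          (by push_cast; linarith) (by push_cast; linarith)
        exact hst y ⟨p + 1, by omega⟩ hy
          (hbr _ ⟨by push_cast; linarith, by push_cast; linarith⟩ hz)
  have low : ∀ n : ℕ, ∀ y ∈ Set.Ioo 0 L, 1 < β ^ (n + 1) * y → 1 < β * (L - y) →
      (interiorExpansions m β y).Nontrivial := by
    intro n
    induction n with
    | zero => intro y hy hy1 hy2; exact mid y hy (by simpa using hy1) hy2
    | succ n ih =>
      intro y hy hy1 hy2
      rcases lt_or_ge 1 (β * y) with h | h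
      · exact mid y hy h hy2
      · refine hst y 0 hy ?_
        simp only [Fin.val_zero, Nat.cast_zero, sub_zero]
        have : 0 < β * y := mul_pos h0 hy.1
        refine ih _ ⟨this, by linarith⟩ ?_ ?_
        · rw [← mul_assoc, ← pow_succ]; exact hy1
        · nlinarith
  have low' : ∀ y ∈ Set.Ioo 0 L, 1 < β * (L - y) → (interiorExpansions m β y).Nontrivial := by
    intro y hy hy2
    obtain ⟨n, hn⟩ := pow_unbounded_of_one_lt y⁻¹ hβ
    refine low n y hy ?_ hy2
    have h3 := hy.1
    have h4 : 1 < β ^ n * y := by rwa [inv_lt_iff_one_lt_mul₀ h3] at hn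
    rw [pow_succ]
    nlinarith
  have high : ∀ n : ℕ, ∀ y ∈ Set.Ioo 0 L, 1 < β ^ (n + 1) * (L - y) →
      (interiorExpansions m β y).Nontrivial := by
    intro n
    induction n with
    | zero => intro y hy hy1; exact low' y hy (by simpa using hy1)
    | succ n ih =>
      intro y hy hy1
      rcases lt_or_ge 1 (β * (L - y)) with h | h
      · exact low' y hy h
      · refine hst y (Fin.last m) hy ?_
        simp only [Fin.val_last]
        have e : L - (β * y - m) = β * (L - y) := by linarith
        have : 0 < β * (L - y) := mul_pos h0 (by linarith [hy.2])
        refine ih _ ⟨by linarith, by linarith⟩ ?_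
        rw [e, ← mul_assoc, ← pow_succ]; exact hy1
  obtain ⟨n, hn⟩ := pow_unbounded_of_one_lt (L - y)⁻¹ hβ
  have h3 : 0 < L - y := by linarith [hy.2]
  refine high n y hy ?_
  have h4 : 1 < β ^ n * (L - y) := by rwa [inv_lt_iff_one_lt_mul₀ h3] at hn
  rw [pow_succ]
  nlinarith

/-! ### The golden ratio. -/

theorem goldenRatio_even (k : ℕ) : goldenRatio (2 * k) = k + 1 := by
  simp [goldenRatio]

theorem goldenRatio_odd (k : ℕ) :
    goldenRatio (2 * k + 1) = (k + 1 + √((k : ℝ) ^ 2 + 6 * k + 5)) / 2 := by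
  have : (2 * k + 1) / 2 = k := by omega
  simp [goldenRatio, this]

theorem goldenRatio_odd_sq (k : ℕ) :
    goldenRatio (2 * k + 1) ^ 2 = (k + 1) * goldenRatio (2 * k + 1) + (k + 1) := by
  rw [goldenRatio_odd]
  have := Real.sq_sqrt (show (0 : ℝ) ≤ (k : ℝ) ^ 2 + 6 * k + 5 by positivity)
  linear_combination this / 4

theorem goldenRatio_odd_gt (k : ℕ) : (k : ℝ) + 1 < goldenRatio (2 * k + 1) := by
  rw [goldenRatio_odd]
  have : (k : ℝ) + 1 < √((k : ℝ) ^ 2 + 6 * k + 5) := by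
    apply Real.lt_sqrt_of_sq_lt
    have : (0 : ℝ) ≤ k := by positivity
    nlinarith
  linarith

theorem one_lt_goldenRatio (hm : 2 ≤ m) : 1 < goldenRatio m := by
  obtain ⟨k, rfl | rfl⟩ := m.even_or_odd'
  · rw [goldenRatio_even]
    have : (1 : ℝ) ≤ k := by exact_mod_cast (by omega : 1 ≤ k)
    linarith
  · have := goldenRatio_odd_gt k
    have : (0 : ℝ) ≤ k := by positivity
    linarith

theorem not_countable_of_lt_goldenRatio (hm : 2 ≤ m) {β : ℝ} (hβ : 1 < β)
    (hG : β < goldenRatio m) {x : ℝ} (hx : x ∈ Set.Ioo 0 ((m : ℝ) / (β - 1))) :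
    ¬ (expansions m β x).Countable := by
  have h01 : 0 < β - 1 := by linarith
  suffices H : 1 < β * ((m : ℝ) / (β - 1) - 1) ∧
      ∀ z, (m : ℝ) / (β - 1) - 1 ≤ z → z ≤ 1 → Branches m β z from
    not_countable_expansions hβ hx fun y hy => nontrivial_interiorExpansions hβ H.1 H.2 hy
  -- Let L = m/(β-1). For m = 2k, L > 2 and [L - 1, 1] is empty. For m = 2k+1, the inequality β² <
  -- (k+1)(β+1) says β - k < L, and this one bound lets digits k and k+1 both be used on all of [L -
  -- 1, 1].
  obtain ⟨k, rfl | rfl⟩ := m.even_or_odd'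
  · rw [goldenRatio_even] at hG
    have hL : 2 < ((2 * k : ℕ) : ℝ) / (β - 1) := by
      rw [lt_div_iff₀ h01]; push_cast; linarith
    exact ⟨by nlinarith, fun z hz hz' => by linarith⟩
  · have hsq := goldenRatio_odd_sq k
    have hk : (0 : ℝ) ≤ k := by positivity
    have hGk := goldenRatio_odd_gt k
    have hq : β ^ 2 < (k + 1) * β + (k + 1) := by nlinarith
    have hL' : ((2 * k + 1 : ℕ) : ℝ) / (β - 1) * β = ((2 * k + 1 : ℕ) : ℝ) / (β - 1) +
      (2 * k + 1 : ℕ) := by field_simp; ring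
    have hL : β - k < ((2 * k + 1 : ℕ) : ℝ) / (β - 1) := by
      rw [lt_div_iff₀ h01]; push_cast; nlinarith
    unfold Branches
    set L := ((2 * k + 1 : ℕ) : ℝ) / (β - 1)
    push_cast at hL'
    refine ⟨by nlinarith, fun z hz hz' => ⟨k, by omega, by nlinarith, by nlinarith⟩⟩

/-- Above the golden ratio the core is nonempty. -/
theorem exists_isCore (hm : 2 ≤ m) {β : ℝ} (hG : goldenRatio m < β) :
    ∃ a : ℕ → Fin (m + 1), IsCore β a ∧ 0 < a 0 ∧ 0 < conj a 1 := by
  have hβ : 1 < β := (one_lt_goldenRatio hm).trans hG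
  have h01 : 0 < β - 1 := by linarith
  obtain ⟨k, rfl | rfl⟩ := m.even_or_odd'
  · rw [goldenRatio_even] at hG
    let a : ℕ → Fin (2 * k + 1) := fun _ => ⟨k, by omega⟩
    have hv : val β a < 1 := by
      rw [val, (hasSum_const_digit hβ (k : ℝ)).tsum_eq, div_lt_one h01]
      linarith
    have hc : conj a = a := by
      funext i
      ext
      simp only [conj_apply, Fin.val_rev, a]
      omega
    have hs : ∀ n, shift n a = a := fun n => rfl
    refine ⟨a, fun n => ?_, ?_, ?_⟩
    · rw [hs, hc]; exact ⟨hv, hv⟩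
    · rw [Fin.lt_def]; simp [a]; omega
    · rw [hc, Fin.lt_def]; simp [a]; omega
  · have hsq := goldenRatio_odd_sq k
    have hk : (0 : ℝ) ≤ k := by positivity
    have hGk := goldenRatio_odd_gt k
    have hq : (k + 1) * β + (k + 1) < β ^ 2 := by nlinarith
    let a : ℕ → Fin (2 * k + 1 + 1) := fun i =>
      if Even i then ⟨k + 1, by omega⟩ else ⟨k, by omega⟩
    have hs1 : shift 1 a = conj a := by
      funext i
      ext
      simp only [conj_apply, Fin.val_rev, a, shift_apply, Nat.even_add_one, add_comm 1 i]
      split_ifs <;> simp <;> omega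
    have hs2 : shift 1 (conj a) = a := by rw [← conj_shift, hs1, conj_conj]
    have hs : ∀ n, shift n a = a ∨ shift n a = conj a := by
      intro n
      induction n with
      | zero => left; simp
      | succ n ih =>
        rw [← shift_shift]
        rcases ih with ih | ih <;> rw [ih]
        · right; exact hs1
        · left; exact hs2
    have e1 := val_succ hβ a
    have e2 := val_succ hβ (conj a)
    rw [hs1, show ((a 0 : ℕ)) = k + 1 from rfl] at e1
    have ha0 : ((conj a 0 : ℕ)) = k := by
      rw [conj_apply, Fin.val_rev, show ((a 0 : ℕ)) = k + 1 from rfl]; omega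
    rw [hs2, ha0] at e2
    push_cast at e1
    -- The value of (k+1 k)^∞, read off from its period 2; it is below 1 exactly when β² >
    -- (k+1)(β+1).
    have e3 : val β a * (β ^ 2 - 1) = (k + 1) * β + k := by linear_combination β * e1 + e2
    have e4 : 0 < β ^ 2 - 1 := by nlinarith
    have hv : val β a < 1 := lt_of_mul_lt_mul_right (by rw [e3]; linarith) e4.le
    have hv' : val β (conj a) < 1 := by nlinarith
    refine ⟨a, fun n => ?_, ?_, ?_⟩
    · rcases hs n with h | h <;> rw [h]
      · exact ⟨hv, hv'⟩
      · rw [conj_conj]; exact ⟨hv', hv⟩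
    · rw [Fin.lt_def]; simp [a]
    · rw [← hs1, shift_apply, Fin.lt_def]; simp [a]

theorem goldenRatio_lt (hm : 2 ≤ m) : goldenRatio m < m + 1 := by
  obtain ⟨k, rfl | rfl⟩ := m.even_or_odd'
  · rw [goldenRatio_even]
    have : (1 : ℝ) ≤ k := by exact_mod_cast (by omega : 1 ≤ k)
    push_cast
    linarith
  · have h1 := goldenRatio_odd_sq k
    have h2 := goldenRatio_odd_gt k
    have : (1 : ℝ) ≤ k := by exact_mod_cast (by omega : 1 ≤ k)
    push_cast
    nlinarith

theorem isGeneralisedGoldenRatio_iff (hm : 2 ≤ m) (g : ℝ) :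
    IsGeneralisedGoldenRatio m g ↔ g = goldenRatio m := by
  have hG1 := one_lt_goldenRatio hm
  have hGm := goldenRatio_lt hm
  have main : IsGeneralisedGoldenRatio m (goldenRatio m) := by
    refine ⟨fun β hβ x hx => not_countable_of_lt_goldenRatio hm hβ.1 hβ.2 hx, fun β hβ => ?_⟩
    have hβ1 : 1 < β := hG1.trans hβ.1
    obtain ⟨a, ha, h0, h1⟩ := exists_isCore hm hβ.1
    refine ⟨val β a, ⟨val_pos hβ1 h0, ?_⟩, encard_expansions_eq_one hβ1 ha.isUniq⟩
    have := val_pos hβ1 h1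
    rw [val_conj hβ1] at this
    linarith
  have clash : ∀ g g' β : ℝ, IsGeneralisedGoldenRatio m g → IsGeneralisedGoldenRatio m g' →
      g < β → β < g' → 1 < β → β ≤ m + 1 → False := by
    intro g g' β hg hg' h1 h2 h3 h4
    obtain ⟨x, hx, hc⟩ := hg.2 β ⟨h1, h4⟩
    obtain ⟨a, ha⟩ := Set.encard_eq_one.mp hc
    exact hg'.1 β ⟨h3, h2⟩ x hx (by rw [ha]; exact Set.countable_singleton a)
  refine ⟨fun hg => ?_, fun h => h ▸ main⟩
  by_contra hne
  rcases lt_or_gt_of_ne hne with h | h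
  -- `g` may be any real number, so the test base is also kept above 1, and below m + 1 in the other
  -- case.
  · obtain ⟨β, h1, h2⟩ := exists_between (max_lt h hG1)
    rw [max_lt_iff] at h1
    exact clash _ _ β hg main h1.1 h2 h1.2 (by linarith)
  · obtain ⟨β, h1, h2⟩ := exists_between (lt_min h hGm)
    rw [lt_min_iff] at h2
    exact clash _ _ β main hg h1 h2.1 (hG1.trans h1) h2.2.le

/-! ### The critical base. -/

theorem isCriticalBase_iff (hm : 2 ≤ m) {β : ℝ} :
    IsCriticalBase m β ↔ 1 < β ∧ val β (critSeq m) = 1 := by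
  refine and_congr_right fun hβ => ?_
  have : (fun i : ℕ => (criticalDigit m (i + 1) : ℝ) / β ^ (i + 1)) =
      fun i : ℕ => ((critSeq m i : ℕ) : ℝ) / β ^ (i + 1) := by
    funext i
    rw [← critSeq_val hm]
    simp
  rw [this]
  exact mem_expansions_iff hβ (critSeq m)

theorem critSeq_zero_pos (hm : 2 ≤ m) : 0 < critSeq m 0 := by
  rw [Fin.lt_def, critSeq_zero hm]; simp

/-- The initial digits already contribute exactly 1: (k+1)/G for m = 2k, and (k+1)/G + (k+1)/G² for
m = 2k+1 by the quadratic equation of G. The remaining digits are not all zero. -/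
theorem one_lt_val_goldenRatio (hm : 2 ≤ m) : 1 < val (goldenRatio m) (critSeq m) := by
  have hG := one_lt_goldenRatio hm
  have h0 := critSeq_zero hm
  have h1 := critSeq_one hm
  have h3 := val_succ hG (critSeq m)
  have h4 := val_shift_succ hG (critSeq m) 1
  have hpos : 0 < val (goldenRatio m) (shift 1 (critSeq m)) :=
    val_pos hG (n := 0) (by rw [shift_apply, Fin.lt_def, h1, Fin.val_zero]; omega)
  have hpos2 : 0 < val (goldenRatio m) (shift (1 + 1) (critSeq m)) := by
    refine val_pos hG (n := 1) ?_
    have h5 := critSeq_last hm 1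
    simp only [pow_one, show 2 ^ (1 + 1) - 1 = 3 from rfl, show 2 - 1 = 1 from rfl] at h5
    rw [shift_apply, Fin.lt_def, show 1 + 1 + 1 = 3 from rfl, Fin.val_zero]
    have := (critSeq m 1).2
    omega
  rw [h0] at h3
  rw [h1] at h4
  obtain ⟨k, rfl | rfl⟩ := m.even_or_odd'
  · rw [show 2 * k / 2 = k by omega] at *
    rw [goldenRatio_even] at *
    push_cast at h3
    nlinarith
  · rw [show (2 * k + 1) / 2 = k by omega] at *
    rw [show 2 * k + 1 - k = k + 1 by omega] at *
    have hsq := goldenRatio_odd_sq k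
    set G := goldenRatio (2 * k + 1)
    push_cast at h3 h4
    by_contra! hle
    have h6 : G ^ 2 * val G (critSeq (2 * k + 1)) =
        (k + 1) * G + (k + 1) + val G (shift (1 + 1) (critSeq (2 * k + 1))) := by
      linear_combination G * h3 + h4
    nlinarith [sq_nonneg G]

theorem val_lt_one_of_base_eq (hm : 2 ≤ m) : val ((m : ℝ) + 1) (critSeq m) < 1 := by
  have hβ : (1 : ℝ) < m + 1 := by
    have : (2 : ℝ) ≤ m := by exact_mod_cast hm
    linarith
  have h1 := critSeq_one hm
  have := val_pos (a := conj (critSeq m)) (n := 1) hβ (by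
    rw [conj_apply, Fin.lt_def, Fin.val_rev, h1, Fin.val_zero]; omega)
  rw [val_conj hβ, add_sub_cancel_right, div_self (by positivity)] at this
  linarith

theorem continuousOn_base {β₀ : ℝ} (hβ : 1 < β₀) (a : ℕ → Fin (m + 1)) :
    ContinuousOn (fun β => val β a) (Set.Ici β₀) := by
  have h0 : (0 : ℝ) < β₀ := by linarith
  refine continuousOn_tsum (u := fun i : ℕ => (m : ℝ) / β₀ ^ (i + 1)) (fun i => ?_)
    (hasSum_const_digit hβ (m : ℝ)).summable (fun i β hi => ?_)
  · refine continuousOn_const.div (by fun_prop) fun β hi => ?_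
    have : 0 < β := h0.trans_le hi
    positivity
  · have h1 : β₀ ≤ β := hi
    have h2 : 0 < β := h0.trans_le hi
    rw [Real.norm_of_nonneg (by positivity)]
    have := digit_le a i
    gcongr

theorem exists_criticalBase (hm : 2 ≤ m) :
    ∃ β, IsCriticalBase m β ∧ goldenRatio m < β ∧ β < m + 1 := by
  have hG := one_lt_goldenRatio hm
  obtain ⟨β, hβ, hv⟩ := intermediate_value_Ioo' (goldenRatio_lt hm).le
    ((continuousOn_base hG (critSeq m)).mono Set.Icc_subset_Ici_self)
    ⟨val_lt_one_of_base_eq hm, one_lt_val_goldenRatio hm⟩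
  exact ⟨β, (isCriticalBase_iff hm).mpr ⟨hG.trans hβ.1, hv⟩, hβ.1, hβ.2⟩

theorem IsCriticalBase.eq (hm : 2 ≤ m) {β γ : ℝ} (h : IsCriticalBase m β)
    (h' : IsCriticalBase m γ) : β = γ := by
  obtain ⟨h1, h2⟩ := (isCriticalBase_iff hm).mp h
  obtain ⟨h3, h4⟩ := (isCriticalBase_iff hm).mp h'
  rcases lt_trichotomy β γ with hlt | heq | hlt
  · have := val_strictAnti h1 hlt (critSeq_zero_pos hm); linarith
  · exact heq
  · have := val_strictAnti h3 hlt (critSeq_zero_pos hm); linarith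

theorem existsUnique_criticalBase (hm : 2 ≤ m) : ∃! β, IsCriticalBase m β := by
  obtain ⟨β, hβ, -⟩ := exists_criticalBase hm
  exact ⟨β, hβ, fun γ hγ => hγ.eq hm hβ⟩

theorem IsCriticalBase.bounds (hm : 2 ≤ m) {β : ℝ} (h : IsCriticalBase m β) :
    goldenRatio m < β ∧ β < m + 1 := by
  obtain ⟨γ, hγ, hb⟩ := exists_criticalBase hm
  rwa [h.eq hm hγ]

/-! ### Rigidity and countability below the critical base. -/

/-- All tails of `a` lie lexicographically between the critical sequence and its reflection. -/
def LexBounded (a : ℕ → Fin (m + 1)) : Prop :=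
  ∀ p N, LexLe N (shift p a) (critSeq m) ∧ LexLe N (conj (shift p a)) (critSeq m)

theorem LexBounded.conj {a : ℕ → Fin (m + 1)} (h : LexBounded a) : LexBounded (conj a) :=
  fun p N => ⟨(h p N).2, by rw [← conj_shift, conj_conj]; exact (h p N).1⟩

theorem IsClosedCore.lexBounded (hm : 2 ≤ m) {β : ℝ} (hβ : IsCriticalBase m β)
    {a : ℕ → Fin (m + 1)} (ha : IsClosedCore β a) : LexBounded a := by
  obtain ⟨h1, h2⟩ := (isCriticalBase_iff hm).mp hβ
  have hc := isClosedCore_critSeq hm h1 h2.le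
  have hlt := (hβ.bounds hm).2
  intro p N
  refine ⟨(ha.shift p).lexLe h1 hlt hc (by rw [h2]; exact (ha p).1) N,
    (ha.shift p).conj.lexLe h1 hlt hc (by rw [h2]; exact (ha p).2) N⟩

/-- The first `2 ^ n` digits of the critical sequence occur in `a` at position `p`. -/
def OccursAt (n : ℕ) (a : ℕ → Fin (m + 1)) (p : ℕ) : Prop :=
  ∀ i < 2 ^ n, a (p + i) = critSeq m i

/-- The upper bound on the tail from `p` and the lower bound on the tail from p + 2^n agree on the
next 2^n - 1 digits and differ by one at the last. The two choices of that digit are the two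
alternatives. -/
theorem LexBounded.next_block (hm : 2 ≤ m) {a : ℕ → Fin (m + 1)} (h : LexBounded a) {n p : ℕ}
    (ho : OccursAt n a p) :
    OccursAt n (BetaExpansion.conj a) (p + 2 ^ n) ∨ OccursAt (n + 1) a p := by
  have hq : 0 < 2 ^ n := by positivity
  have upper : ∀ i, i < 2 ^ n → (∀ x < i, a (p + 2 ^ n + x) = critSeq m (2 ^ n + x)) →
      a (p + 2 ^ n + i) ≤ critSeq m (2 ^ n + i) := by
    intro i hi hx
    have := (h p (2 ^ n + i + 1)).1 (2 ^ n + i) (by omega) (fun y hy => ?_)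
    · rwa [shift_apply, ← add_assoc] at this
    · rw [shift_apply]
      rcases Nat.lt_or_ge y (2 ^ n) with h1 | h1
      · exact ho y h1
      · obtain ⟨z, rfl⟩ := Nat.exists_eq_add_of_le h1
        rw [← add_assoc]
        exact hx z (by omega)
  have lower : ∀ i, (∀ x < i, a (p + 2 ^ n + x) = Fin.rev (critSeq m x)) →
      Fin.rev (critSeq m i) ≤ a (p + 2 ^ n + i) := by
    intro i hx
    have := (h (p + 2 ^ n) (i + 1)).2 i (by omega) (fun y hy => by
      rw [conj_apply, shift_apply, hx y hy, Fin.rev_rev])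
    rw [conj_apply, shift_apply] at this
    rwa [← Fin.rev_le_rev, Fin.rev_rev]
  have mid : ∀ i, i + 1 < 2 ^ n → a (p + 2 ^ n + i) = Fin.rev (critSeq m i) := by
    intro i
    induction i using Nat.strong_induction_on with
    | _ i ih =>
      intro hi
      refine le_antisymm ?_ (lower i fun x hx => ih x hx (by omega))
      rw [← critSeq_add hm hi]
      refine upper i (by omega) fun x hx => ?_
      rw [ih x hx (by omega), critSeq_add hm (by omega)]
  have h1 := lower (2 ^ n - 1) (fun x hx => mid x (by omega))
  have h2 := upper (2 ^ n - 1) (by omega) (fun x hx => by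
    rw [mid x (by omega), critSeq_add hm (by omega)])
  have h3 := critSeq_last hm n
  have hp : 2 ^ (n + 1) = 2 ^ n + 2 ^ n := by ring
  rw [hp, show 2 ^ n + 2 ^ n - 1 = 2 ^ n + (2 ^ n - 1) by omega] at h3
  rcases h1.eq_or_lt with h4 | h4
  · left
    intro i hi
    rw [conj_apply]
    rcases Nat.lt_or_ge (i + 1) (2 ^ n) with h5 | h5
    · rw [mid i h5, Fin.rev_rev]
    · obtain rfl : i = 2 ^ n - 1 := by omega
      rw [← h4, Fin.rev_rev]
  · right
    intro i hi
    rcases Nat.lt_or_ge i (2 ^ n) with h5 | h5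
    · exact ho i h5
    · obtain ⟨x, rfl⟩ := Nat.exists_eq_add_of_le h5
      rw [← add_assoc]
      rcases Nat.lt_or_ge (x + 1) (2 ^ n) with h6 | h6
      · rw [mid x h6, critSeq_add hm h6]
      · obtain rfl : x = 2 ^ n - 1 := by omega
        refine le_antisymm h2 ?_
        rw [Fin.lt_def, Fin.val_rev] at h4
        rw [Fin.le_def]
        omega

/-- The periodic sequence `(w w̄)^∞`, where `w` is the prefix of length `2 ^ n` of the critical
sequence. -/
def periodicSeq (m n : ℕ) : ℕ → Fin (m + 1) := fun i =>
  if Even (i / 2 ^ n) then critSeq m (i % 2 ^ n) else Fin.rev (critSeq m (i % 2 ^ n))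

theorem LexBounded.shift_eq_periodicSeq (hm : 2 ≤ m) {a : ℕ → Fin (m + 1)} (h : LexBounded a)
    {n p : ℕ} (ho : OccursAt n a p) (h1 : ∀ q, ¬ OccursAt (n + 1) a q)
    (h2 : ∀ q, ¬ OccursAt (n + 1) (BetaExpansion.conj a) q) : shift p a = periodicSeq m n := by
  have hq : 0 < 2 ^ n := by positivity
  have key : ∀ j, if Even j then OccursAt n a (p + 2 ^ n * j)
      else OccursAt n (BetaExpansion.conj a) (p + 2 ^ n * j) := by
    intro j
    induction j with
    | zero => simpa using ho
    | succ j ih =>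
      rw [show p + 2 ^ n * (j + 1) = p + 2 ^ n * j + 2 ^ n by ring]
      simp only [Nat.even_add_one]
      by_cases hj : Even j
      · rw [if_pos hj] at ih
        rw [if_neg (not_not.mpr hj)]
        exact (h.next_block hm ih).resolve_right (h1 _)
      · rw [if_neg hj] at ih
        rw [if_pos hj]
        have := (h.conj.next_block hm ih).resolve_right (h2 _)
        rwa [conj_conj] at this
  funext i
  have hi := key (i / 2 ^ n)
  have hlt := Nat.mod_lt i hq
  have hdm : p + 2 ^ n * (i / 2 ^ n) + i % 2 ^ n = p + i := by
    have := Nat.div_add_mod i (2 ^ n)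
    omega
  rw [shift_apply, periodicSeq]
  split_ifs at hi ⊢ with he
  · rw [← hi _ hlt, hdm]
  · rw [← hi _ hlt, hdm, conj_apply, Fin.rev_rev]

/-- A countable set that contains a tail of every sequence with few long critical blocks. -/
def tailSet (m : ℕ) : Set (ℕ → Fin (m + 1)) :=
  {fun _ => Fin.ofNat (m + 1) (m / 2)} ∪ Set.range (periodicSeq m) ∪
    Set.range (fun n => conj (periodicSeq m n))

theorem tailSet_countable (m : ℕ) : (tailSet m).Countable :=
  ((Set.countable_singleton _).union (Set.countable_range _)).union (Set.countable_range _)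

theorem LexBounded.exists_shift_mem (hm : 2 ≤ m) {a : ℕ → Fin (m + 1)} (h : LexBounded a) (n : ℕ)
    (h1 : ∀ q, ¬ OccursAt n a q) (h2 : ∀ q, ¬ OccursAt n (BetaExpansion.conj a) q) :
    ∃ p, shift p a ∈ tailSet m := by
  induction n with
  | zero =>
    -- With k = m / 2, all digits lie strictly between m - k - 1 and k + 1: they equal k when m is
    -- even, and none exists when m is odd.
    refine ⟨0, Or.inl (Or.inl ?_)⟩
    rw [Set.mem_singleton_iff, shift_zero]
    funext i
    have h3 := (h i 1).1 0 (by omega) (by simp)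
    have h4 := (h i 1).2 0 (by omega) (by simp)
    have h5 : a i ≠ critSeq m 0 := fun he => h1 i fun j hj => by
      obtain rfl : j = 0 := by simpa using hj
      exact he
    have h6 : Fin.rev (a i) ≠ critSeq m 0 := fun he => h2 i fun j hj => by
      obtain rfl : j = 0 := by simpa using hj
      exact he
    have h0 := critSeq_zero hm
    simp only [shift_apply, conj_apply, add_zero] at h3 h4
    rw [Ne, Fin.ext_iff] at h5 h6
    rw [Fin.le_def] at h3 h4
    rw [Fin.val_rev] at h4 h6
    ext
    rw [Fin.val_ofNat, Nat.mod_eq_of_lt (by omega)]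
    omega
  | succ n ih =>
    by_cases h3 : ∃ p, OccursAt n a p
    · obtain ⟨p, hp⟩ := h3
      exact ⟨p, Or.inl (Or.inr ⟨n, (h.shift_eq_periodicSeq hm hp h1 h2).symm⟩)⟩
    by_cases h4 : ∃ p, OccursAt n (BetaExpansion.conj a) p
    · obtain ⟨p, hp⟩ := h4
      refine ⟨p, Or.inr ⟨n, ?_⟩⟩
      have := h.conj.shift_eq_periodicSeq hm hp h2 (by rwa [conj_conj])
      simp only
      rw [← this, ← conj_shift, conj_conj]
    · exact ih (fun q hq => h3 ⟨q, hq⟩) (fun q hq => h4 ⟨q, hq⟩)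

/-- Below the critical base the critical sequence has value above 1, and so does one of its partial
sums. The level found depends on the base alone, not on the sequence. -/
theorem exists_not_occursAt (hm : 2 ≤ m) {β γ : ℝ} (hβ : 1 < β) (hγ : IsCriticalBase m γ)
    (hlt : β < γ) :
    ∃ n, ∀ (a : ℕ → Fin (m + 1)) (p : ℕ), val β (shift p a) < 1 → ¬ OccursAt n a p := by
  have h0 : (0 : ℝ) < β := by linarith
  obtain ⟨h1, h2⟩ := (isCriticalBase_iff hm).mp hγ
  have h3 := val_strictAnti hβ hlt (critSeq_zero_pos hm)
  rw [h2] at h3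
  obtain ⟨n, hn⟩ := ((summable_digits hβ (critSeq m)).hasSum.tendsto_sum_nat.eventually
    (lt_mem_nhds h3)).exists
  refine ⟨n, fun a p hv ho => ?_⟩
  have h4 := sum_le_val hβ (shift p a) n
  rw [Finset.sum_congr rfl fun i hi => by
    rw [shift_apply, ho i ((Finset.mem_range.mp hi).trans Nat.lt_two_pow_self)]] at h4
  linarith

theorem countable_eventually {S : Set (ℕ → Fin (m + 1))} (hS : S.Countable) :
    {a : ℕ → Fin (m + 1) | ∃ n, shift n a ∈ S}.Countable := by
  rw [Set.ofPred_exists]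
  refine Set.countable_iUnion fun n => ?_
  have h1 : ((Set.univ : Set (Fin n → Fin (m + 1))) ×ˢ S).Countable :=
    (Set.countable_univ).prod hS
  refine Set.MapsTo.countable_of_injOn
    (f := fun a : ℕ → Fin (m + 1) => ((fun i : Fin n => a i), shift n a)) (t := Set.univ ×ˢ S)
    (fun a ha => ⟨Set.mem_univ _, ha⟩) (fun a _ b _ hab => ?_) h1
  simp only [Prod.mk.injEq] at hab
  funext i
  rcases Nat.lt_or_ge i n with hi | hi
  · exact congrFun hab.1 ⟨i, hi⟩
  · obtain ⟨j, rfl⟩ := Nat.exists_eq_add_of_le hi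
    exact congrFun hab.2 j

theorem countable_isUniq (hm : 2 ≤ m) {β γ : ℝ} (hβ : 1 < β) (hγ : IsCriticalBase m γ)
    (hlt : β < γ) : {a : ℕ → Fin (m + 1) | IsUniq β a}.Countable := by
  obtain ⟨hγ1, hγ2⟩ := hγ.bounds hm
  obtain ⟨n, hn⟩ := exists_not_occursAt hm hβ hγ hlt
  refine ((countable_eventually (tailSet_countable m)).union
    ((Set.countable_singleton (fun _ => Fin.last m)).union
      (Set.countable_singleton (fun _ => 0)))).mono fun a ha => ?_
  rcases IsUniq.eventually_isCore hβ (by linarith) ha with h | h | ⟨N, hN⟩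
  · exact Or.inr (Or.inl h)
  · exact Or.inr (Or.inr h)
  · left
    -- Raising the base to γ lowers values, so the core at β lies in the closed core at γ, where the
    -- lexicographic bounds hold.
    have hN' : IsClosedCore γ (shift N a) := fun i =>
      ⟨(val_anti hβ hlt.le _).trans (hN i).1.le, (val_anti hβ hlt.le _).trans (hN i).2.le⟩
    obtain ⟨p, hp⟩ := (hN'.lexBounded hm hγ).exists_shift_mem hm n
      (fun q => hn _ q (hN q).1) (fun q => hn _ q (hN q).2)
    rw [shift_shift] at hp
    exact ⟨_, hp⟩

/-- A leading 0 divides the value by β, and a digit 0 imposes no reflected condition, so zeros may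
precede a core sequence though the result can leave the core. -/
theorem IsCore.isUniq_zero_splice {β : ℝ} (hβ : 1 < β) {a : ℕ → Fin (m + 1)} (h : IsCore β a)
    (n : ℕ) : IsUniq β (splice n (fun _ => 0) a) := by
  have h0 : (0 : ℝ) < β := by linarith
  intro k
  rcases Nat.lt_or_ge k n with hk | hk
  · rw [splice_of_lt hk]
    refine ⟨fun _ => ?_, fun h => absurd h (lt_irrefl _)⟩
    suffices H : ∀ l ≤ n, val β (shift (n - l) (splice n (fun _ => 0) a)) < 1 by
      have := H (n - (k + 1)) (by omega)
      rwa [show n - (n - (k + 1)) = k + 1 by omega] at this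
    intro l
    induction l with
    | zero => intro _; rw [Nat.sub_zero, shift_splice]; simpa using (h 0).1
    | succ l ih =>
      intro hl
      have h1 := val_shift_succ hβ (splice n (fun _ => 0) a) (n - (l + 1))
      rw [splice_of_lt (by omega), show n - (l + 1) + 1 = n - l by omega] at h1
      have h2 := ih (by omega)
      simp only [Fin.val_zero, Nat.cast_zero, zero_add] at h1
      nlinarith
  · obtain ⟨l, rfl⟩ := Nat.exists_eq_add_of_le hk
    rw [add_assoc, ← shift_shift, shift_splice]
    exact ⟨fun _ => (h _).1, fun _ => (h _).2⟩

theorem infinite_isUniq (hm : 2 ≤ m) {β : ℝ} (hG : goldenRatio m < β) :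
    {a : ℕ → Fin (m + 1) | IsUniq β a}.Infinite := by
  have hβ : 1 < β := (one_lt_goldenRatio hm).trans hG
  obtain ⟨a, ha, h0, -⟩ := exists_isCore hm hG
  have hne : ∀ n k : ℕ, n < k → splice n (fun _ => 0) a ≠ splice k (fun _ => 0) a := by
    intro n k hnk he
    have := congrFun he n
    rw [splice_of_lt hnk] at this
    simp only [splice, lt_irrefl, if_false, Nat.sub_self] at this
    exact absurd this h0.ne'
  refine Set.infinite_of_injective_forall_mem (f := fun n => splice n (fun _ => 0) a)
    (fun n k he => ?_) (fun n => ha.isUniq_zero_splice hβ n)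
  rcases lt_trichotomy n k with h | h | h
  · exact absurd he (hne n k h)
  · exact h
  · exact absurd he.symm (hne k n h)

theorem mk_uniqueSet_of_lt (hm : 2 ≤ m) {β γ : ℝ} (hG : goldenRatio m < β)
    (hγ : IsCriticalBase m γ) (hlt : β < γ) :
    Cardinal.mk (uniqueSet m β) = Cardinal.aleph0 := by
  have hβ : 1 < β := (one_lt_goldenRatio hm).trans hG
  have hγ2 := (hγ.bounds hm).2
  rw [uniqueSet_eq_image hβ (by linarith), Cardinal.mk_image_eq_of_injOn _ _ (injOn_val_isUniq hβ)]
  have h1 := (countable_isUniq hm hβ hγ hlt).to_subtype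
  have h2 := (infinite_isUniq hm hG).to_subtype
  exact Cardinal.mk_eq_aleph0 _

/-! ### The continuum at the critical base. -/

/-- The critical sequence is not eventually periodic. -/
theorem critSeq_shift_injective (hm : 2 ≤ m) :
    Function.Injective (fun n => shift n (critSeq m)) := by
  have key : ∀ n p : ℕ, 0 < p → shift n (critSeq m) ≠ shift (n + p) (critSeq m) := by
    intro n p hp he
    have hdig : ∀ i ≥ n, criticalDigit m (i + 1) = criticalDigit m (i + p + 1) := by
      intro i hi
      obtain ⟨j, rfl⟩ := Nat.exists_eq_add_of_le hi
      have h1 := congrFun he j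
      simp only [shift_apply] at h1
      rw [← critSeq_val hm, ← critSeq_val hm, h1, show n + p + j = n + j + p by ring]
    by_cases hme : Even m
    · simp only [criticalDigit, if_pos hme, Nat.add_sub_cancel] at hdig
      -- For even m the digits see only increments of λ, so a period p makes λ_{i+p} - λ_i a
      -- constant d. Three periods give |3d| ≤ 1, hence d = 0.
      set d := thueMorse (n + p) - thueMorse n with hd
      have hconst : ∀ i ≥ n, thueMorse (i + p) - thueMorse i = d := by
        intro i hi
        induction i, hi using Nat.le_induction with
        | base => rfl
        | succ i hi ih =>
          have := hdig i hi
          rw [show i + 1 + p = i + p + 1 by ring]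
          omega
      have h1 := hconst n le_rfl
      have h2 := hconst (n + p) (by omega)
      have h3 := hconst (n + p + p) (by omega)
      have hd0 : d = 0 := by
        rcases thueMorse_eq_zero_or_one n with h4 | h4 <;>
        rcases thueMorse_eq_zero_or_one (n + p + p + p) with h5 | h5 <;> omega
      obtain ⟨i, hi, hne⟩ := thueMorse_not_periodic hp n
      have := hconst i hi
      exact hne (by omega)
    · simp only [criticalDigit, if_neg hme] at hdig
      obtain ⟨i, hi, hne⟩ := thueMorse_not_periodic hp (n + 1)
      have := hdig (i - 1) (by omega)
      rw [show i - 1 + 1 = i by omega, show i - 1 + p + 1 = i + p by omega] at this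
      exact hne (by omega)
  intro n k he
  simp only at he
  rcases lt_trichotomy n k with h | h | h
  · obtain ⟨p, rfl⟩ := Nat.exists_eq_add_of_lt h
    exact absurd he (key n (p + 1) (by omega))
  · exact h
  · obtain ⟨p, rfl⟩ := Nat.exists_eq_add_of_lt h
    exact absurd he.symm (key k (p + 1) (by omega))

/-- Every prefix of the critical sequence occurs again in it. -/
theorem critSeq_recurrent (hm : 2 ≤ m) (N : ℕ) :
    ∃ p > 0, ∀ i < N, critSeq m (p + i) = critSeq m i := by
  have h1 : N + 1 < 2 ^ (N + 1) := Nat.lt_two_pow_self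
  have hp : 0 < 2 ^ (N + 1) := by positivity
  have h2 : 2 ^ (N + 2) = 2 * 2 ^ (N + 1) := by ring
  -- Two distinct powers of 2 reflect the prefix twice.
  refine ⟨2 ^ (N + 2) + 2 ^ (N + 1), by omega, fun i hi => ?_⟩
  rw [add_assoc, critSeq_add hm (by omega), critSeq_add hm (by omega), Fin.rev_rev]

theorem mk_uniqueSet_critical (hm : 2 ≤ m) {β : ℝ} (hβ : IsCriticalBase m β) :
    Cardinal.mk (uniqueSet m β) = Cardinal.continuum := by
  obtain ⟨h1, h2⟩ := (isCriticalBase_iff hm).mp hβ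
  obtain ⟨hG, hlt⟩ := hβ.bounds hm
  have hcont : ∀ n, Continuous (shift n : (ℕ → Fin (m + 1)) → _) := fun n =>
    continuous_pi fun i => continuous_apply (n + i)
  have hcontc : Continuous (conj : (ℕ → Fin (m + 1)) → _) :=
    continuous_pi fun i => continuous_of_discreteTopology.comp (continuous_apply i)
  have hclosed : IsClosed {a : ℕ → Fin (m + 1) | IsClosedCore β a} := by
    simp only [IsClosedCore, Set.ofPred_forall]
    exact isClosed_iInter fun n =>
      (isClosed_le ((continuous_val h1).comp (hcont n)) continuous_const).inter
        (isClosed_le ((continuous_val h1).comp (hcontc.comp (hcont n))) continuous_const)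
  have hcrit := isClosedCore_critSeq hm h1 h2.le
  -- Recurrence and aperiodicity leave the orbit of the critical sequence without isolated points.
  obtain ⟨f, hinj, hf⟩ := exists_cantor_injection
    (A := Set.range fun n => shift n (critSeq m)) (Set.range_nonempty _)
    (by
      rintro _ ⟨n, rfl⟩ N
      obtain ⟨p, hp, hrec⟩ := critSeq_recurrent hm (n + N)
      refine ⟨_, ⟨p + n, rfl⟩, fun i hi => ?_, fun he => ?_⟩
      · simp only [shift_apply]
        rw [add_assoc]
        exact hrec _ (by omega)
      · have := critSeq_shift_injective hm he
        omega)
    hclosed (by rintro _ ⟨n, rfl⟩; exact hcrit.shift n)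
  -- A closed-core sequence outside the core has a tail or reflected tail of value exactly 1. By
  -- injectivity of values that tail is the critical sequence or its reflection: countably many
  -- exceptions.
  set B : Set (ℕ → Fin (m + 1)) :=
    {a | ∃ n, shift n a ∈ ({critSeq m, conj (critSeq m)} : Set (ℕ → Fin (m + 1)))} with hB
  have hBc : B.Countable := countable_eventually (Set.toFinite _).countable
  have hcore : ∀ x ∈ (f ⁻¹' B)ᶜ, IsUniq β (f x) := by
    intro x hx
    refine IsCore.isUniq fun n => ⟨lt_of_le_of_ne (hf x n).1 fun he => hx ⟨n, Or.inl ?_⟩,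
      lt_of_le_of_ne (hf x n).2 fun he => hx ⟨n, Or.inr ?_⟩⟩
    · exact (IsClosedCore.shift (hf x) n).eq_of_val_eq h1 hlt hcrit (he.trans h2.symm)
    · have := (IsClosedCore.shift (hf x) n).conj.eq_of_val_eq h1 hlt hcrit (he.trans h2.symm)
      rw [Set.mem_singleton_iff, ← this, conj_conj]
  have hmkB : Cardinal.mk (ℕ → Bool) = Cardinal.continuum := by simp
  have hpre : (f ⁻¹' B).Countable := hBc.preimage hinj
  have hcompl : Cardinal.mk ((f ⁻¹' B)ᶜ : Set (ℕ → Bool)) = Cardinal.continuum := by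
    rw [← hmkB]
    refine Cardinal.mk_compl_of_infinite _ ?_
    rw [hmkB]
    exact (Cardinal.mk_le_aleph0_iff.mpr hpre.to_subtype).trans_lt Cardinal.aleph0_lt_continuum
  apply le_antisymm
  · exact (Cardinal.mk_set_le _).trans Cardinal.mk_real.le
  · rw [← hcompl]
    refine Cardinal.mk_le_of_injective
      (f := fun x : ((f ⁻¹' B)ᶜ : Set (ℕ → Bool)) =>
        (⟨val β (f x), (hcore x x.2).val_mem_uniqueSet h1⟩ : uniqueSet m β)) ?_
    intro x y hxy
    exact Subtype.ext (hinj ((hcore y y.2).eq_of_val_eq h1 (Subtype.ext_iff.mp hxy)))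

/-! ### Positive dimension above the critical base. -/

/-- A set of reals coded by binary sequences with exponential separation has positive dimension. -/
theorem dimH_range_pos {x : (ℕ → Fin 2) → ℝ} {D ρ : ℝ} (hD : 0 < D) (hρ0 : 0 < ρ) (hρ1 : ρ < 1)
    (h : ∀ (ω ω' : ℕ → Fin 2) (i : ℕ), (∀ k < i, ω k = ω' k) → ω i ≠ ω' i →
      D * ρ ^ (i + 1) ≤ |x ω - x ω'|) : 0 < dimH (Set.range x) := by
  have hinj : Function.Injective x := by
    intro ω ω' he
    by_contra hne
    obtain ⟨i, hi, hd⟩ := exists_first_diff (m := 1) hne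
    have := h ω ω' i hi hd
    rw [he, sub_self, abs_zero] at this
    have : 0 < D * ρ ^ (i + 1) := by positivity
    linarith
  -- The exponent r with ρ^r = 1/2 makes the map from `x ω` to the binary value of ω r-Hölder. Its
  -- image is [0, 1], which has dimension 1.
  have hr : 0 < Real.logb ρ (1 / 2) :=
    Real.logb_pos_of_base_lt_one hρ0 hρ1 (by norm_num) (by norm_num)
  have hρr : ρ ^ Real.logb ρ (1 / 2) = 1 / 2 := Real.rpow_logb hρ0 hρ1.ne (by norm_num)
  set r := Real.logb ρ (1 / 2)
  have hbound : ∀ ω ω' : ℕ → Fin 2,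
      |val 2 ω - val 2 ω'| ≤ 2 * D⁻¹ ^ r * |x ω - x ω'| ^ r := by
    intro ω ω'
    rcases eq_or_ne ω ω' with rfl | hne
    · simp only [sub_self, abs_zero]; positivity
    obtain ⟨i, hi, hd⟩ := exists_first_diff (m := 1) hne
    have h1 : |val 2 ω - val 2 ω'| ≤ 1 / 2 ^ i := by
      have h2 : ∀ a : ℕ → Fin 2, 0 ≤ val 2 a ∧ val 2 a ≤ 1 := fun a =>
        ⟨val_nonneg (m := 1) one_lt_two a, by
          have := val_le (m := 1) one_lt_two a; norm_num at this; exact this⟩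
      rw [val_sub_of_agree (m := 1) one_lt_two hi, abs_div, abs_of_pos (by positivity : (0 : ℝ) < 2 ^ i)]
      gcongr
      rw [abs_le]
      have h3 := h2 (shift (m := 1) i ω)
      have h4 := h2 (shift (m := 1) i ω')
      constructor <;> linarith
    have h3 : ρ ^ (i + 1) ≤ D⁻¹ * |x ω - x ω'| := by
      rw [inv_mul_eq_div, le_div_iff₀ hD, mul_comm]
      exact h ω ω' i hi hd
    calc |val 2 ω - val 2 ω'| ≤ 1 / 2 ^ i := h1
      _ = 2 * (1 / 2) ^ (i + 1) := by rw [pow_succ, one_div_pow]; ring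
      _ = 2 * (ρ ^ (i + 1)) ^ r := by
        rw [← hρr, ← Real.rpow_natCast, ← Real.rpow_natCast, ← Real.rpow_mul hρ0.le,
          ← Real.rpow_mul hρ0.le, mul_comm r]
      _ ≤ 2 * (D⁻¹ * |x ω - x ω'|) ^ r := by gcongr
      _ = _ := by rw [Real.mul_rpow (by positivity) (by positivity), mul_assoc]
  let g : ℝ → ℝ := fun y => val (m := 1) 2 (Function.invFun x y)
  have hg : ∀ ω, g (x ω) = val (m := 1) 2 ω := fun ω => by
    simp only [g, Function.leftInverse_invFun hinj ω]
  have hC : 0 ≤ 2 * D⁻¹ ^ r := by positivity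
  have hhol : HolderOnWith (2 * D⁻¹ ^ r).toNNReal r.toNNReal g (Set.range x) := by
    rintro _ ⟨ω, rfl⟩ _ ⟨ω', rfl⟩
    rw [hg, hg, edist_dist, edist_dist, Real.dist_eq, Real.dist_eq]
    rw [Real.coe_toNNReal r hr.le, ENNReal.ofReal_rpow_of_nonneg (abs_nonneg _) hr.le,
      ← ENNReal.ofReal, ← ENNReal.ofReal_mul hC]
    exact ENNReal.ofReal_le_ofReal (hbound ω ω')
  have himg : g '' Set.range x = Set.Icc 0 1 := by
    ext y
    constructor
    · rintro ⟨_, ⟨ω, rfl⟩, rfl⟩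
      rw [hg]
      refine ⟨val_nonneg (m := 1) one_lt_two ω, ?_⟩
      have := val_le (m := 1) one_lt_two ω; norm_num at this; exact this
    · intro hy
      obtain ⟨ω, hω⟩ := exists_val_eq (m := 1) (β := 2) (x := y) one_lt_two (by norm_num)
        (by norm_num; exact hy)
      exact ⟨x ω, ⟨ω, rfl⟩, by rw [hg, hω]⟩
  have hdim := hhol.dimH_image_le (Real.toNNReal_pos.mpr hr)
  rw [himg, Real.dimH_of_nonempty_interior (by rw [interior_Icc]; exact ⟨1 / 2, by norm_num⟩)] at hdim
  by_contra h0
  rw [not_lt, nonpos_iff_eq_zero] at h0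
  rw [h0, ENNReal.zero_div] at hdim
  simp at hdim

/-- The concatenation of the blocks of length `2 ^ n` of the critical sequence with indices
`b 0, b 1, …`. -/
def blockSeq (m n : ℕ) (b : ℕ → ℕ) : ℕ → Fin (m + 1) := fun p =>
  critSeq m (2 ^ n * b (p / 2 ^ n) + p % 2 ^ n)

theorem critSeq_block_three (hm : 2 ≤ m) {n i : ℕ} (hi : i < 2 ^ n) :
    critSeq m (2 ^ n * 3 + i) = critSeq m i := by
  have hp : 2 ^ (n + 1) = 2 * 2 ^ n := by ring
  have hp' : 2 ^ (n + 2) = 4 * 2 ^ n := by ring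
  rcases Nat.lt_or_ge (i + 1) (2 ^ n) with h | h
  · rw [show 2 ^ n * 3 + i = 2 ^ (n + 1) + (2 ^ n + i) by omega, critSeq_add hm (by omega),
      critSeq_add hm h, Fin.rev_rev]
  · have h1 := critSeq_last hm n
    have h2 := critSeq_last hm (n + 1)
    rw [show 2 ^ (n + 1 + 1) - 1 = 2 ^ n * 3 + i by omega] at h2
    rw [show 2 ^ n - 1 = i by omega] at h1
    ext
    omega

theorem critSeq_block_four (hm : 2 ≤ m) {n i : ℕ} (hi : i < 2 ^ n) :
    critSeq m (2 ^ n * 4 + i) = critSeq m (2 ^ n * 2 + i) := by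
  have h0 : 0 < 2 ^ n := by positivity
  have hp : 2 ^ (n + 1) = 2 ^ n * 2 := by ring
  have hp' : 2 ^ (n + 2) = 2 ^ n * 4 := by ring
  rw [← hp, ← hp', critSeq_add hm (by omega), critSeq_add hm (by omega)]

/-- The critical sequence begins with the blocks 0 1 2 0 2, since block 3 equals block 0 and block 4
equals block 2. Each allowed transition therefore occurs in it, and a window of length 2^n meets at
most two blocks. -/
theorem blockSeq_window (hm : 2 ≤ m) (n : ℕ) {b : ℕ → ℕ}
    (hb : ∀ u, b u = 0 ∧ b (u + 1) = 1 ∨ b u = 0 ∧ b (u + 1) = 2 ∨ b u = 1 ∧ b (u + 1) = 2 ∨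
      b u = 2 ∧ b (u + 1) = 0) (p : ℕ) :
    ∃ s, ∀ i < 2 ^ n, blockSeq m n b (p + i) = critSeq m (s + i) := by
  have h0 : 0 < 2 ^ n := by positivity
  obtain ⟨s, hs1, hs2⟩ : ∃ s, (∀ i < 2 ^ n,
      critSeq m (2 ^ n * b (p / 2 ^ n) + i) = critSeq m (2 ^ n * s + i)) ∧
      ∀ i < 2 ^ n, critSeq m (2 ^ n * b (p / 2 ^ n + 1) + i) = critSeq m (2 ^ n * (s + 1) + i) := by
    rcases hb (p / 2 ^ n) with ⟨h1, h2⟩ | ⟨h1, h2⟩ | ⟨h1, h2⟩ | ⟨h1, h2⟩ <;> rw [h1, h2]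
    · exact ⟨0, fun _ _ => rfl, fun _ _ => rfl⟩
    · exact ⟨3, fun i hi => by rw [critSeq_block_three hm hi]; simp,
        fun i hi => (critSeq_block_four hm hi).symm⟩
    · exact ⟨1, fun _ _ => rfl, fun _ _ => rfl⟩
    · exact ⟨2, fun _ _ => rfl, fun i hi => by rw [critSeq_block_three hm hi]; simp⟩
  have hdm := Nat.div_add_mod p (2 ^ n)
  have hmod := Nat.mod_lt p h0
  refine ⟨2 ^ n * s + p % 2 ^ n, fun i hi => ?_⟩
  rw [blockSeq]
  rcases Nat.lt_or_ge (p % 2 ^ n + i) (2 ^ n) with h | h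
  · have e : p + i = p % 2 ^ n + i + 2 ^ n * (p / 2 ^ n) := by omega
    rw [e, Nat.add_mul_div_left _ _ h0, Nat.add_mul_mod_self_left, Nat.div_eq_of_lt h,
      Nat.mod_eq_of_lt h, zero_add, hs1 _ h, add_assoc]
  · obtain ⟨j, hj⟩ := Nat.exists_eq_add_of_le h
    have hj' : j < 2 ^ n := by omega
    have e : p + i = j + 2 ^ n * (p / 2 ^ n + 1) := by rw [mul_add]; omega
    rw [e, Nat.add_mul_div_left _ _ h0, Nat.add_mul_mod_self_left, Nat.div_eq_of_lt hj',
      Nat.mod_eq_of_lt hj', zero_add, hs2 _ hj']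
    congr 1
    rw [mul_add]
    omega

/-- The block indices `0 2 0 1 2` or `0 1 2 0 2`, according to the digits of `ω`. -/
def blockCode (ω : ℕ → Fin 2) (j : ℕ) : ℕ :=
  if j % 5 = 0 then 0 else if j % 5 = 4 then 2
  else if ω (j / 5) = 0 then (if j % 5 = 1 then 2 else if j % 5 = 2 then 0 else 1)
  else (if j % 5 = 1 then 1 else if j % 5 = 2 then 2 else 0)

theorem blockCode_step (ω : ℕ → Fin 2) (u : ℕ) :
    blockCode ω u = 0 ∧ blockCode ω (u + 1) = 1 ∨ blockCode ω u = 0 ∧ blockCode ω (u + 1) = 2 ∨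
    blockCode ω u = 1 ∧ blockCode ω (u + 1) = 2 ∨ blockCode ω u = 2 ∧ blockCode ω (u + 1) = 0 := by
  unfold blockCode
  have h : u % 5 = 0 ∨ u % 5 = 1 ∨ u % 5 = 2 ∨ u % 5 = 3 ∨ u % 5 = 4 := by omega
  rcases h with h | h | h | h | h
  · have h1 : (u + 1) % 5 = 1 := by omega
    have h2 : (u + 1) / 5 = u / 5 := by omega
    by_cases hω : ω (u / 5) = 0 <;> simp [h, h1, h2, hω]
  · have h1 : (u + 1) % 5 = 2 := by omega
    have h2 : (u + 1) / 5 = u / 5 := by omega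
    by_cases hω : ω (u / 5) = 0 <;> simp [h, h1, h2, hω]
  · have h1 : (u + 1) % 5 = 3 := by omega
    have h2 : (u + 1) / 5 = u / 5 := by omega
    by_cases hω : ω (u / 5) = 0 <;> simp [h, h1, h2, hω]
  · have h1 : (u + 1) % 5 = 4 := by omega
    by_cases hω : ω (u / 5) = 0 <;> simp [h, h1, hω]
  · have h1 : (u + 1) % 5 = 0 := by omega
    simp [h, h1]

theorem blockCode_one (ω : ℕ → Fin 2) (i : ℕ) :
    blockCode ω (5 * i + 1) = if ω i = 0 then 2 else 1 := by
  have h1 : (5 * i + 1) % 5 = 1 := by omega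
  have h2 : (5 * i + 1) / 5 = i := by omega
  simp [blockCode, h1, h2]

/-- Blocks 1 and 2 differ only in their last digit, hence the offset 2^n - 1; the code shows its
binary digit in the block 5i + 1. -/
theorem blockSeq_blockCode_ne (hm : 2 ≤ m) (n : ℕ) {ω ω' : ℕ → Fin 2} {i : ℕ} (h : ω i ≠ ω' i) :
    blockSeq m n (blockCode ω) (2 ^ n * (5 * i + 1) + (2 ^ n - 1)) ≠
      blockSeq m n (blockCode ω') (2 ^ n * (5 * i + 1) + (2 ^ n - 1)) := by
  have h0 : 0 < 2 ^ n := by positivity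
  have key : critSeq m (2 ^ n * 2 + (2 ^ n - 1)) ≠ critSeq m (2 ^ n * 1 + (2 ^ n - 1)) := by
    have h1 := critSeq_last hm n
    have hp : 2 ^ (n + 1) = 2 ^ n * 2 := by ring
    rw [show 2 ^ (n + 1) - 1 = 2 ^ n * 1 + (2 ^ n - 1) by omega] at h1
    rw [← hp, critSeq_add hm (by omega), Ne, Fin.ext_iff, Fin.val_rev]
    have := (critSeq m (2 ^ n - 1)).2
    omega
  have e1 : (2 ^ n * (5 * i + 1) + (2 ^ n - 1)) / 2 ^ n = 5 * i + 1 := by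
    rw [Nat.mul_add_div h0, Nat.div_eq_of_lt (by omega), add_zero]
  have e2 : (2 ^ n * (5 * i + 1) + (2 ^ n - 1)) % 2 ^ n = 2 ^ n - 1 := by
    rw [Nat.mul_add_mod, Nat.mod_eq_of_lt (by omega)]
  simp only [blockSeq, e1, e2, blockCode_one]
  by_cases hω : ω i = 0 <;> by_cases hω' : ω' i = 0
  · exact absurd (hω.trans hω'.symm) h
  · rw [if_pos hω, if_neg hω']; exact key
  · rw [if_neg hω, if_pos hω']; exact key.symm
  · exact absurd (by omega) h

theorem LexLe.congr_left {N : ℕ} {a a' b : ℕ → Fin (m + 1)} (h : LexLe N a b)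
    (ha : ∀ i < N, a' i = a i) : LexLe N a' b := fun j hj hij => by
  rw [ha j hj]
  exact h j hj fun i hi => by rw [← ha i (by omega)]; exact hij i hi

/-- With L = m/(β-1) ≥ 1, tails lie in [L - θ, θ]. At the first difference a digit gap of 1
therefore leaves at least 1 - (2θ - L) ≥ 2(1 - θ). -/
theorem abs_val_sub_ge {β θ : ℝ} (hβ : 1 < β) (hβm : β ≤ m + 1)
    {a b : ℕ → Fin (m + 1)}
    (ha : ∀ n, val β (shift n a) ≤ θ ∧ val β (conj (shift n a)) ≤ θ)
    (hb : ∀ n, val β (shift n b) ≤ θ ∧ val β (conj (shift n b)) ≤ θ) {j : ℕ} (hj : a j ≠ b j) :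
    2 * (1 - θ) / β ^ (j + 1) ≤ |val β a - val β b| := by
  have h0 : (0 : ℝ) < β := by linarith
  have hL : 1 ≤ (m : ℝ) / (β - 1) := by rw [le_div_iff₀ (by linarith)]; linarith
  obtain ⟨i, hi, hd⟩ := exists_first_diff (fun he => hj (congrFun he j) : a ≠ b)
  have hij : i ≤ j := not_lt.mp fun hlt => hj (hi j hlt)
  have key := val_sub_of_agree_succ hβ hi
  have h1 := ha (i + 1)
  have h2 := hb (i + 1)
  rw [val_conj hβ] at h1 h2
  have h3 : 2 * (1 - θ) ≤ |β ^ (i + 1) * (val β a - val β b)| := by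
    rw [key]
    rcases lt_or_gt_of_ne hd with h | h
    · have h4 : ((a i : ℕ) : ℝ) + 1 ≤ (b i : ℕ) := by exact_mod_cast h
      refine le_trans ?_ (neg_le_abs _)
      linarith
    · have h4 : ((b i : ℕ) : ℝ) + 1 ≤ (a i : ℕ) := by exact_mod_cast h
      refine le_trans ?_ (le_abs_self _)
      linarith
  rw [abs_mul, abs_of_pos (pow_pos h0 _)] at h3
  rw [div_le_iff₀ (by positivity), mul_comm |_|]
  refine h3.trans ?_
  have : β ^ (i + 1) ≤ β ^ (j + 1) := pow_le_pow_right₀ hβ.le (by omega)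
  gcongr

theorem dimH_uniqueSet_pos (hm : 2 ≤ m) {β γ : ℝ} (hγ : IsCriticalBase m γ) (hlt : γ < β)
    (hβm : β ≤ m + 1) : 0 < dimH (uniqueSet m β) := by
  obtain ⟨hγ1, hγ2⟩ := (isCriticalBase_iff hm).mp hγ
  have hβ : 1 < β := hγ1.trans hlt
  have h0 : 0 < β := by linarith
  -- Windows of length 2^n taken from the critical sequence bound tails at γ by 1 plus a small
  -- error; n is chosen so that the factor γ/β gained in passing to β outweighs it.
  obtain ⟨n, hn⟩ : ∃ n : ℕ, γ * (1 + m / (γ - 1) / γ ^ (2 ^ n)) < β := by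
    have h1 : Tendsto (fun M : ℕ => γ * (1 + m / (γ - 1) * (γ⁻¹) ^ M)) atTop
        (𝓝 (γ * (1 + m / (γ - 1) * 0))) :=
      (((tendsto_pow_atTop_nhds_zero_of_lt_one (inv_nonneg.mpr (by linarith))
        (inv_lt_one_of_one_lt₀ hγ1)).const_mul _).const_add _).const_mul _
    rw [mul_zero, add_zero, mul_one] at h1
    obtain ⟨N, hN⟩ := (h1.eventually (gt_mem_nhds hlt)).exists_forall_of_atTop
    refine ⟨N, ?_⟩
    have := hN (2 ^ N) Nat.lt_two_pow_self.le
    rwa [inv_pow, ← div_eq_mul_inv] at this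
  set θ := γ * (1 + m / (γ - 1) / γ ^ (2 ^ n)) / β with hθ
  have hθ1 : θ < 1 := by rw [hθ, div_lt_one h0]; exact hn
  have hbd : ∀ ω p, val β (shift p (blockSeq m n (blockCode ω))) ≤ θ ∧
      val β (conj (shift p (blockSeq m n (blockCode ω)))) ≤ θ := by
    intro ω p
    have hw := blockSeq_window hm n (blockCode_step ω)
    have h1 : ∀ p, LexLe (2 ^ n) (shift p (blockSeq m n (blockCode ω))) (critSeq m) := by
      intro p
      obtain ⟨s, hs⟩ := hw p
      exact (critSeq_shift_le hm s _).congr_left hs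
    have h2 : ∀ p, LexLe (2 ^ n) (shift p (conj (blockSeq m n (blockCode ω)))) (critSeq m) := by
      intro p
      obtain ⟨s, hs⟩ := hw p
      have h3 := (critSeq_conj_le hm s (2 ^ n)).conj
      rw [conj_conj] at h3
      exact h3.congr_left fun i hi => congrArg Fin.rev (hs i hi)
    have h4 : ∀ a : ℕ → Fin (m + 1), val γ a ≤ 1 + m / (γ - 1) / γ ^ (2 ^ n) → val β a ≤ θ := by
      intro a ha
      rw [hθ, le_div_iff₀ h0, mul_comm]
      refine (mul_val_le_mul_val hγ1 hlt.le a).trans ?_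
      gcongr
    exact ⟨h4 _ (val_shift_le_of_lexLe hγ1 hγ2.le h1 p),
      h4 _ (val_shift_le_of_lexLe hγ1 hγ2.le h2 p)⟩
  have hpos : 0 < dimH (Set.range fun ω => val β (blockSeq m n (blockCode ω))) := by
    -- Each binary digit costs five blocks of length 2^n, whence the ratio β^(-5·2^n).
    refine dimH_range_pos (D := 2 * (1 - θ)) (ρ := (β ^ (5 * 2 ^ n))⁻¹) (by linarith)
      (by positivity) (inv_lt_one_of_one_lt₀ (one_lt_pow₀ hβ (by positivity))) ?_
    intro ω ω' i _ hne
    refine le_trans ?_ (abs_val_sub_ge hβ hβm (hbd ω) (hbd ω')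
      (blockSeq_blockCode_ne hm n hne))
    rw [inv_pow, ← pow_mul, ← div_eq_mul_inv]
    have hq : 0 < 2 ^ n := by positivity
    have : 0 ≤ 2 * (1 - θ) := by linarith
    have : β ^ (2 ^ n * (5 * i + 1) + (2 ^ n - 1) + 1) ≤ β ^ (5 * 2 ^ n * (i + 1)) := by
      refine pow_le_pow_right₀ hβ.le ?_
      have e1 : 2 ^ n * (5 * i + 1) + (2 ^ n - 1) + 1 = 5 * (2 ^ n * i) + 2 * 2 ^ n := by
        rw [mul_add, mul_left_comm]; omega
      have e2 : 5 * 2 ^ n * (i + 1) = 5 * (2 ^ n * i) + 5 * 2 ^ n := by ring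
      omega
    gcongr
  refine hpos.trans_le (dimH_mono ?_)
  rintro _ ⟨ω, rfl⟩
  refine IsUniq.val_mem_uniqueSet hβ (IsCore.isUniq fun p => ?_)
  exact ⟨(hbd ω p).1.trans_lt hθ1, (hbd ω p).2.trans_lt hθ1⟩

end BetaExpansion

end

theorem mainTheorem4 (m : ℕ) (hm : 2 ≤ m) :
    (∀ g : ℝ, BetaExpansion.IsGeneralisedGoldenRatio m g ↔ g = BetaExpansion.goldenRatio m) ∧
    (∃! βc : ℝ, BetaExpansion.IsCriticalBase m βc) ∧
    ∀ βc : ℝ, BetaExpansion.IsCriticalBase m βc →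
      BetaExpansion.goldenRatio m < βc ∧ βc < (m : ℝ) + 1 ∧
      (∀ β ∈ Set.Ioo (BetaExpansion.goldenRatio m) βc,
        Cardinal.mk (BetaExpansion.uniqueSet m β) = Cardinal.aleph0) ∧
      Cardinal.mk (BetaExpansion.uniqueSet m βc) = Cardinal.continuum ∧
      (∀ β ∈ Set.Ioc βc ((m : ℝ) + 1), 0 < dimH (BetaExpansion.uniqueSet m β)) := by
  refine ⟨BetaExpansion.isGeneralisedGoldenRatio_iff hm,
    BetaExpansion.existsUnique_criticalBase hm, fun βc hc => ?_⟩
  obtain ⟨hG, hlt⟩ := hc.bounds hm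
  exact ⟨hG, hlt, fun β hβ => BetaExpansion.mk_uniqueSet_of_lt hm hβ.1 hc hβ.2,
    BetaExpansion.mk_uniqueSet_critical hm hc,
    fun β hβ => BetaExpansion.dimH_uniqueSet_pos hm hc hβ.1 hβ.2⟩
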